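/- Let $N,d$ be dimensions. For a finite Borel measure $\nu$ of bounded support on $\mathbb R^n$, $q>0$, $q\neq1$ and $r>0$, let $M_r(q)=\sum_C\nu(C)^q$, the sum being over the mesh cubes $C=\prod_{i=1}^n[k_ir,(k_i+1)r)$, $k\in\mathbb Z^n$, and define the lower and upper generalized $q$-dimensions $$\underline D_q(\nu)=\liminf_{r\to0^+}\frac{\log M_r(q)}{(q-1)\log r},\qquad \overline D_q(\nu)=\limsup_{r\to0^+}\frac{\log M_r(q)}{(q-1)\log r}.$$ Let $X_0:\mathbb R^N\to\mathbb R$ be a mean zero Gaussian process with $X_0(0)=0$ a.s., and let $X=(X_1,\dots,X_d):\mathbb R^N\to\mathbb R^d$ be a random field with almost surely continuous sample paths, where $X_1,\dots,X_d$ are independent copies of $X_0$. Let $\delta_0>0$ and let $\psi:[0,\delta_0)\to[0,\infty)$ be non-decreasing and right continuous with $\psi(0)=0$ and, for some constant $C_1>0$, $\psi(2r)\le C_1\psi(r)$ for all $r\in(0,\delta_0/2)$. Assume condition (C1): there is a constant $C_2>0$ such that $$\mathbb E\big[(X_0(x+h)-X_0(x))^2\big]\le C_2\,\psi(|h|)\qquad\text{for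 all }x,h\in\mathbb R^N\text{ with }|h|<\delta_0 .$$ Define the upper and lower indices of $\psi$ at $0$ by $$\alpha^*=\inf\Big\{\beta\ge0:\lim_{r\to0^+}\frac{\psi(r)}{r^{2\beta}}=\infty\Big\}\ (\inf\emptyset=\infty),\qquad \alpha_*=\sup\Big\{\beta\ge0:\lim_{r\to0^+}\frac{\psi(r)}{r^{2\beta}}=0\Big\}.$$ Let $\mu$ be a Borel probability measure on $\mathbb R^N$ with compact support, let $\mu_X$ be the random image measure $\mu_X(A)=\mu\{x:X(x)\in A\}$ on $\mathbb R^d$, and let $q>0$, $q\ne1$. (i) If $0<\alpha_*=\alpha^*=\alpha<1$, then $$\underline D_q(\mu_X)\le\min\Big\{d,\tfrac1\alpha\underline D_q(\mu)\Big\}\ \text{ a.s.}\quad\text{and}\quad \overline D_q(\mu_X)\le\min\Big\{d,\tfrac1\alpha\overline D_q(\mu)\Big\}\ \text{ a.s.}$$ (ii) If $0<\alpha_*\le\alpha^*<1$, then $$\underline D_q(\mu_X)\le\min\Big\{d,\tfrac1{\alpha^*}\overline D_q(\mu)\Big\}\ \text{ a.s.}\quad\text{and}\quad \overline D_q(\mu_X)\le\min\Big\{d,\tfrac1{\alpha_*}\overline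 D_q(\mu)\Big\}\ \text{ a.s.}$$ -/

import Mathlib

open MeasureTheory ProbabilityTheory Filter Topology
open scoped ENNReal

noncomputable section

namespace RenyiImage

/-- The `r`-mesh cube `∏ᵢ [kᵢ r, (kᵢ + 1) r)` of `ℝⁿ` with integer index `k`. -/
def meshCube {n : ℕ} (r : ℝ) (k : Fin n → ℤ) : Set (EuclideanSpace ℝ (Fin n)) :=
  {x | ∀ i, (k i : ℝ) * r ≤ x i ∧ x i < ((k i : ℝ) + 1) * r}

/-- The `q`-th moment sum `M_r(q) = ∑_C ν(C) ^ q` over all `r`-mesh cubes `C`. -/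
def momentSum {n : ℕ} (ν : Measure (EuclideanSpace ℝ (Fin n))) (q r : ℝ) : ℝ≥0∞ :=
  ∑' k : Fin n → ℤ, ν (meshCube r k) ^ q

/-- The quotient `log M_r(q) / ((q - 1) log r)`, with `log 0 = -∞` and `log ∞ = ∞`. -/
def dimQuotient {n : ℕ} (ν : Measure (EuclideanSpace ℝ (Fin n))) (q r : ℝ) : EReal :=
  ENNReal.log (momentSum ν q r) / (((q - 1) * Real.log r : ℝ) : EReal)

/-- Lower generalized `q`-dimension (lower Rényi dimension). -/
def lowerDim {n : ℕ} (q : ℝ) (ν : Measure (EuclideanSpace ℝ (Fin n))) : EReal :=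
  liminf (fun r : ℝ => dimQuotient ν q r) (𝓝[>] 0)

/-- Upper generalized `q`-dimension (upper Rényi dimension). -/
def upperDim {n : ℕ} (q : ℝ) (ν : Measure (EuclideanSpace ℝ (Fin n))) : EReal :=
  limsup (fun r : ℝ => dimQuotient ν q r) (𝓝[>] 0)

/-- Upper index of `ψ` at `0`: `α^* = inf {β ≥ 0 : lim_{r → 0+} ψ(r) / r ^ (2β) = ∞}`,
where `inf ∅ = ∞`. -/
def upperIndex (ψ : ℝ → ℝ) : EReal :=
  sInf {b : EReal | ∃ β : ℝ, 0 ≤ β ∧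
    Tendsto (fun r : ℝ => ψ r / r ^ (2 * β)) (𝓝[>] 0) atTop ∧ b = (β : EReal)}

/-- Lower index of `ψ` at `0`: `α_* = sup {β ≥ 0 : lim_{r → 0+} ψ(r) / r ^ (2β) = 0}`. -/
def lowerIndex (ψ : ℝ → ℝ) : EReal :=
  sSup {b : EReal | ∃ β : ℝ, 0 ≤ β ∧
    Tendsto (fun r : ℝ => ψ r / r ^ (2 * β)) (𝓝[>] 0) (𝓝 0) ∧ b = (β : EReal)}

/-- `ψ : [0, δ₀) → [0, ∞)` is non-decreasing, right continuous, vanishes at `0` and is doubling.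
Only the values of `ψ` on `[0, δ₀)` matter; they are nonnegative by the first two fields. -/
structure IsGauge (δ₀ : ℝ) (ψ : ℝ → ℝ) : Prop where
  zero : ψ 0 = 0
  mono : MonotoneOn ψ (Set.Ico 0 δ₀)
  rightCont : ∀ r ∈ Set.Ico 0 δ₀, ContinuousWithinAt ψ (Set.Ici r) r
  doubling : ∃ C₁ : ℝ, 0 < C₁ ∧ ∀ r ∈ Set.Ioo 0 (δ₀ / 2), ψ (2 * r) ≤ C₁ * ψ r

/-- The increment variance bound `E[(X₀(x + h) - X₀(x))²] ≤ C₂ ψ(|h|)` for `|h| < δ₀`. -/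
def IncrementVarianceBound {N : ℕ} {Ω₀ : Type*} [MeasurableSpace Ω₀] (P₀ : Measure Ω₀)
    (X₀ : EuclideanSpace ℝ (Fin N) → Ω₀ → ℝ) (δ₀ : ℝ) (ψ : ℝ → ℝ) : Prop :=
  ∃ C₂ : ℝ, 0 < C₂ ∧ ∀ x h : EuclideanSpace ℝ (Fin N), ‖h‖ < δ₀ →
    ∫ ω, (X₀ (x + h) ω - X₀ x ω) ^ 2 ∂P₀ ≤ C₂ * ψ ‖h‖

/-- `X₀ : ℝᴺ → ℝ` is a mean zero Gaussian process with `X₀(0) = 0` a.s. -/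
structure IsCenteredGaussianField {N : ℕ} {Ω₀ : Type*} [MeasurableSpace Ω₀] (P₀ : Measure Ω₀)
    (X₀ : EuclideanSpace ℝ (Fin N) → Ω₀ → ℝ) : Prop where
  gaussian : IsGaussianProcess X₀ P₀
  mean_zero : ∀ x, ∫ ω, X₀ x ω ∂P₀ = 0
  at_zero : ∀ᵐ ω ∂P₀, X₀ 0 ω = 0

/-- `X = (X₁, …, X_d) : ℝᴺ → ℝᵈ` is a random field with a.s. continuous sample paths whose
coordinate processes are independent copies of `X₀`: mutually independent (as random elements of
`ℝ^(ℝᴺ)` with the product σ-algebra), each with the same finite-dimensional distributions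
as `X₀`. -/
structure IsFieldOfIndepCopies {N d : ℕ} {Ω₀ Ω : Type*} [MeasurableSpace Ω₀] [MeasurableSpace Ω]
    (P₀ : Measure Ω₀) (X₀ : EuclideanSpace ℝ (Fin N) → Ω₀ → ℝ)
    (P : Measure Ω) (X : EuclideanSpace ℝ (Fin N) → Ω → EuclideanSpace ℝ (Fin d)) : Prop where
  measurable : ∀ x, Measurable (X x)
  continuous : ∀ᵐ ω ∂P, Continuous fun x => X x ω
  copies : ∀ (i : Fin d) (I : Finset (EuclideanSpace ℝ (Fin N))),
    IdentDistrib (fun ω (x : I) => X x ω i) (fun ω (x : I) => X₀ x ω) P P₀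
  indep : iIndepFun (fun (i : Fin d) ω (x : EuclideanSpace ℝ (Fin N)) => X x ω i) P

/-- The random image measure `μ_X(A) = μ {x : X(x) ∈ A}` at the sample point `ω`. -/
def imageMeasure {N d : ℕ} {Ω : Type*} (μ : Measure (EuclideanSpace ℝ (Fin N)))
    (X : EuclideanSpace ℝ (Fin N) → Ω → EuclideanSpace ℝ (Fin d)) (ω : Ω) :
    Measure (EuclideanSpace ℝ (Fin d)) :=
  μ.map fun x => X x ω

end RenyiImage

end

/-!
Two mechanisms carry the proof.

*Deterministic part.* Suppose that `f` moves points of a set of full `μ`-measure by at most a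
constant multiple of `r ^ β` (in each coordinate) whenever they differ by at most `r`. Then the
image of an `r`-mesh cube meets a bounded number of `r ^ β`-mesh cubes, so the moment sums of `μ` at
scale `r` and of the image measure at scale `r ^ β` compare up to a constant, in the direction that
bounds the dimension of the image from above (`OscBound.momentSum_le` for `q > 1` and
`OscBound.momentSum_map_le` for `q < 1`). Dividing by `(q - 1) log r ^ β`, a bound `L` for the
quotient of `μ` at scale `r` becomes `L / β + o(1)` for the image at scale `r ^ β`
(`OscBound.dimQuotient_map_le`). If the oscillation bound holds at all small scales, this passes to
both the lower and the upper limit; if it holds along a sequence of scales only, it still bounds the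
lower dimension of the image by the upper dimension of `μ`. The bound by `d` is a count of mesh
cubes (`upperDim_le_of_bounded`).

*Probabilistic part.* For `β` below the lower index, `ψ r ≤ r ^ (2 β)` at all small scales, and for
`β` below the upper index `ψ r ≤ M r ^ (2 β)` along a sequence of scales. Along scales which decrease
at least geometrically, Gaussian tails beat any polynomial number of events, so by Borel–Cantelli the
increments over pairs of points at distance `O(r)` in a lattice of mesh `r ^ κ` are almost surely at
most `r ^ β'`, for any `β' < β` and any `κ` (`ae_eventually_gridBound`). With `κ = 1` and dyadic
scales, chaining along dyadic lattices gives Hölder continuity with any exponent `γ` below the lower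
index (`ae_exists_eventually_oscBound`). Below the upper index, `κ` is chosen so large that Hölder
continuity makes the rounding errors `(r ^ κ) ^ γ` smaller than `r ^ β'`
(`ae_exists_frequently_oscBound`); this needs the lower index to be positive.
-/

namespace RenyiImage

/-! ### Power sums of nonnegative arrays -/

theorem sum_rpow_le_rpow_sum {ι : Type*} (s : Finset ι) (f : ι → ℝ≥0∞) {q : ℝ} (hq : 1 ≤ q) :
    ∑ i ∈ s, f i ^ q ≤ (∑ i ∈ s, f i) ^ q := by
  classical
  induction s using Finset.induction_on with
  | empty => simp [ENNReal.zero_rpow_of_pos (by linarith : 0 < q)]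
  | insert i s hi ih =>
    rw [Finset.sum_insert hi, Finset.sum_insert hi]
    exact (add_le_add le_rfl ih).trans (ENNReal.add_rpow_le_rpow_add _ _ hq)

theorem tsum_rpow_le_rpow_tsum {ι : Type*} (f : ι → ℝ≥0∞) {q : ℝ} (hq : 1 ≤ q) :
    ∑' i, f i ^ q ≤ (∑' i, f i) ^ q := by
  rw [ENNReal.tsum_eq_iSup_sum]
  refine iSup_le fun s => (sum_rpow_le_rpow_sum s f hq).trans ?_
  exact ENNReal.rpow_le_rpow (ENNReal.sum_le_tsum s) (by linarith)

theorem rpow_tsum_le_tsum_rpow {ι : Type*} (f : ι → ℝ≥0∞) {q : ℝ} (hq : 0 < q) (hq1 : q ≤ 1) :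
    (∑' i, f i) ^ q ≤ ∑' i, f i ^ q := by
  have h := tsum_rpow_le_rpow_tsum (fun i => f i ^ q) (q := q⁻¹) ((one_le_inv₀ hq).2 hq1)
  simp only [ENNReal.rpow_rpow_inv hq.ne'] at h
  exact (ENNReal.le_rpow_inv_iff hq).1 h

/-- If every row of `a` has at most `K` nonzero entries, then the `q`-th power sum of the row sums
is at most `K ^ (q - 1)` times that of the column sums, for `q ≥ 1`. -/
theorem tsum_rpow_rows_le {ι κ : Type*} (a : ι → κ → ℝ≥0∞) (S : ι → Finset κ) (K : ℕ)
    (hcard : ∀ k, (S k).card ≤ K) (hzero : ∀ k, ∀ l ∉ S k, a k l = 0) {q : ℝ} (hq : 1 ≤ q) :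
    ∑' k, (∑' l, a k l) ^ q ≤ (K : ℝ≥0∞) ^ (q - 1) * ∑' l, (∑' k, a k l) ^ q := by
  have hrow : ∀ k, (∑' l, a k l) ^ q ≤ (K : ℝ≥0∞) ^ (q - 1) * ∑' l, a k l ^ q := by
    intro k
    rw [tsum_eq_sum (hzero k)]
    refine (ENNReal.rpow_sum_le_const_mul_sum_rpow (S k) (a k) hq).trans ?_
    gcongr
    · exact hcard k
    · exact ENNReal.sum_le_tsum _
  calc ∑' k, (∑' l, a k l) ^ q
      ≤ ∑' k, (K : ℝ≥0∞) ^ (q - 1) * ∑' l, a k l ^ q := ENNReal.tsum_le_tsum hrow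
    _ = (K : ℝ≥0∞) ^ (q - 1) * ∑' l, ∑' k, a k l ^ q := by
        rw [ENNReal.tsum_mul_left, ENNReal.tsum_comm]
    _ ≤ _ := by
        gcongr with l
        exact tsum_rpow_le_rpow_tsum _ hq

/-- The counterpart of `tsum_rpow_rows_le` for `q ≤ 1`, with rows and columns exchanged. -/
theorem tsum_rpow_columns_le {ι κ : Type*} (a : ι → κ → ℝ≥0∞) (S : ι → Finset κ) (K : ℕ)
    (hcard : ∀ k, (S k).card ≤ K) (hzero : ∀ k, ∀ l ∉ S k, a k l = 0) {q : ℝ} (hq : 0 < q)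
    (hq1 : q ≤ 1) :
    ∑' l, (∑' k, a k l) ^ q ≤ (K : ℝ≥0∞) ^ (1 - q) * ∑' k, (∑' l, a k l) ^ q := by
  have hrow : ∀ k, ∑' l, a k l ^ q ≤ (K : ℝ≥0∞) ^ (1 - q) * (∑' l, a k l) ^ q := by
    intro k
    rw [tsum_eq_sum (hzero k), tsum_eq_sum (s := S k)
      (fun l hl => by rw [hzero k l hl, ENNReal.zero_rpow_of_pos hq])]
    have h := ENNReal.rpow_sum_le_const_mul_sum_rpow (S k) (fun l => a k l ^ q) (p := q⁻¹)
      ((one_le_inv₀ hq).2 hq1)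
    simp only [ENNReal.rpow_rpow_inv hq.ne'] at h
    have h' := ENNReal.rpow_le_rpow h hq.le
    rw [ENNReal.rpow_inv_rpow hq.ne', ENNReal.mul_rpow_of_nonneg _ _ hq.le,
      ← ENNReal.rpow_mul, sub_mul, inv_mul_cancel₀ hq.ne', one_mul] at h'
    refine h'.trans ?_
    gcongr
    exact hcard k
  calc ∑' l, (∑' k, a k l) ^ q
      ≤ ∑' l, ∑' k, a k l ^ q := ENNReal.tsum_le_tsum fun l => rpow_tsum_le_tsum_rpow _ hq hq1
    _ = ∑' k, ∑' l, a k l ^ q := ENNReal.tsum_comm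
    _ ≤ ∑' k, (K : ℝ≥0∞) ^ (1 - q) * (∑' l, a k l) ^ q := ENNReal.tsum_le_tsum hrow
    _ = _ := ENNReal.tsum_mul_left

/-! ### Mesh cubes and moment sums -/

theorem mem_meshCube_iff {n : ℕ} {r : ℝ} (hr : 0 < r) {k : Fin n → ℤ}
    {x : EuclideanSpace ℝ (Fin n)} : x ∈ meshCube r k ↔ ∀ i, ⌊x i / r⌋ = k i := by
  refine forall_congr' fun i => ?_
  rw [Int.floor_eq_iff, le_div_iff₀ hr, div_lt_iff₀ hr]

theorem measurableSet_meshCube {n : ℕ} (r : ℝ) (k : Fin n → ℤ) :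
    MeasurableSet (meshCube (n := n) r k) := by
  have : meshCube r k = ⋂ i, (fun x : EuclideanSpace ℝ (Fin n) => x i) ⁻¹'
      Set.Ico ((k i : ℝ) * r) (((k i : ℝ) + 1) * r) := by
    ext x; simp [meshCube]
  rw [this]
  exact MeasurableSet.iInter fun i => (by fun_prop : Measurable fun x :
    EuclideanSpace ℝ (Fin n) => x i) measurableSet_Ico

theorem tsum_measure_inter_meshCube {α : Type*} [MeasurableSpace α] {n : ℕ} (μ : Measure α)
    {f : α → EuclideanSpace ℝ (Fin n)} (hf : Measurable f) {r : ℝ} (hr : 0 < r) {A : Set α}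
    (hA : MeasurableSet A) : ∑' k : Fin n → ℤ, μ (A ∩ f ⁻¹' meshCube r k) = μ A := by
  rw [← measure_iUnion]
  · congr 1
    ext x
    simp only [Set.mem_iUnion, Set.mem_inter_iff, Set.mem_preimage, mem_meshCube_iff hr]
    exact ⟨fun ⟨_, h, _⟩ => h, fun h => ⟨fun i => ⌊f x i / r⌋, h, fun _ => rfl⟩⟩
  · intro k l hkl
    refine Set.disjoint_left.2 fun x hx hy => hkl (funext fun i => ?_)
    rw [← (mem_meshCube_iff hr).1 hx.2 i, (mem_meshCube_iff hr).1 hy.2 i]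
  · exact fun k => hA.inter (hf (measurableSet_meshCube r k))

/-- Points of `B` whose coordinates differ by at most `r` have images whose coordinates differ by
at most `m ρ`. -/
def OscBound {n d : ℕ} (f : EuclideanSpace ℝ (Fin n) → EuclideanSpace ℝ (Fin d))
    (B : Set (EuclideanSpace ℝ (Fin n))) (r ρ : ℝ) (m : ℕ) : Prop :=
  ∀ x ∈ B, ∀ y ∈ B, (∀ i, |x i - y i| ≤ r) → ∀ j, |f x j - f y j| ≤ m * ρ

theorem OscBound.floor_mem_Icc {n d : ℕ} {f : EuclideanSpace ℝ (Fin n) → EuclideanSpace ℝ (Fin d)}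
    {B : Set (EuclideanSpace ℝ (Fin n))} {r ρ : ℝ} {m : ℕ} (h : OscBound f B r ρ m)
    (hρ : 0 < ρ) {k : Fin n → ℤ} {x y : EuclideanSpace ℝ (Fin n)}
    (hx : x ∈ B) (hy : y ∈ B) (hxk : x ∈ meshCube r k) (hyk : y ∈ meshCube r k) (j : Fin d) :
    ⌊f y j / ρ⌋ ∈ Finset.Icc (⌊f x j / ρ⌋ - (m : ℤ)) (⌊f x j / ρ⌋ + (m : ℤ)) := by
  have hd := h x hx y hy (fun i => by
    have h1 := hxk i; have h2 := hyk i
    rw [abs_le]; constructor <;> nlinarith) j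
  rw [abs_le] at hd
  have e1 : f y j / ρ ≤ f x j / ρ + (m : ℤ) := by
    rw [div_add' _ _ _ hρ.ne']; push_cast; gcongr; linarith
  have e2 : f x j / ρ ≤ f y j / ρ + (m : ℤ) := by
    rw [div_add' _ _ _ hρ.ne']; push_cast; gcongr; linarith
  have := Int.floor_le_floor e1
  have := Int.floor_le_floor e2
  rw [Int.floor_add_intCast] at *
  rw [Finset.mem_Icc]; omega

/-- The mesh cubes of side `ρ` met by the image of a fixed mesh cube of side `r` have their indices
in a finite set of `(2 m + 1) ^ d` elements. -/
theorem OscBound.exists_finset {n d : ℕ} {f : EuclideanSpace ℝ (Fin n) → EuclideanSpace ℝ (Fin d)}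
    {B : Set (EuclideanSpace ℝ (Fin n))} {r ρ : ℝ} {m : ℕ} (h : OscBound f B r ρ m)
    (hρ : 0 < ρ) (k : Fin n → ℤ) :
    ∃ S : Finset (Fin d → ℤ), S.card ≤ (2 * m + 1) ^ d ∧
      ∀ l ∉ S, meshCube r k ∩ f ⁻¹' meshCube ρ l ⊆ Bᶜ := by
  by_cases hne : ∃ x ∈ B, x ∈ meshCube r k
  · obtain ⟨x, hx, hxk⟩ := hne
    refine ⟨Fintype.piFinset fun j =>
      Finset.Icc (⌊f x j / ρ⌋ - (m : ℤ)) (⌊f x j / ρ⌋ + (m : ℤ)), ?_, ?_⟩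
    · rw [Fintype.card_piFinset]
      simp only [Int.card_Icc]
      rw [Finset.prod_congr rfl (fun j _ => (by omega :
        (⌊f x j / ρ⌋ + (m : ℤ) + 1 - (⌊f x j / ρ⌋ - (m : ℤ))).toNat = 2 * m + 1))]
      simp
    · rintro l hl y ⟨hyk, hyl⟩ hy
      refine hl (Fintype.mem_piFinset.2 fun j => ?_)
      rw [← (mem_meshCube_iff hρ).1 hyl j]
      exact h.floor_mem_Icc hρ hx hy hxk hyk j
  · push Not at hne
    exact ⟨∅, by simp, fun l _ y hy hyB => hne y hyB hy.1⟩

section Comparison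

variable {n d : ℕ} {μ : Measure (EuclideanSpace ℝ (Fin n))}
  {f : EuclideanSpace ℝ (Fin n) → EuclideanSpace ℝ (Fin d)} {B : Set (EuclideanSpace ℝ (Fin n))}
  {r ρ q : ℝ} {m : ℕ}

theorem momentSum_eq_tsum_rows (μ : Measure (EuclideanSpace ℝ (Fin n))) (hf : Measurable f)
    (q r : ℝ) (hρ : 0 < ρ) : momentSum μ q r =
      ∑' k : Fin n → ℤ, (∑' l : Fin d → ℤ, μ (meshCube r k ∩ f ⁻¹' meshCube ρ l)) ^ q := by
  simp only [tsum_measure_inter_meshCube μ hf hρ (measurableSet_meshCube r _), momentSum]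

theorem momentSum_map_eq_tsum_columns (μ : Measure (EuclideanSpace ℝ (Fin n))) (hf : Measurable f)
    (q ρ : ℝ) (hr : 0 < r) : momentSum (μ.map f) q ρ =
      ∑' l : Fin d → ℤ, (∑' k : Fin n → ℤ, μ (meshCube r k ∩ f ⁻¹' meshCube ρ l)) ^ q := by
  unfold momentSum
  refine tsum_congr fun l => ?_
  rw [Measure.map_apply hf (measurableSet_meshCube ρ l),
    ← tsum_measure_inter_meshCube μ measurable_id hr (hf (measurableSet_meshCube ρ l))]
  simp only [Set.preimage_id, Set.inter_comm]

theorem OscBound.momentSum_le (h : OscBound f B r ρ m) (hf : Measurable f) (hB : μ Bᶜ = 0)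
    (hr : 0 < r) (hρ : 0 < ρ) (hq : 1 ≤ q) :
    momentSum μ q r ≤ (((2 * m + 1) ^ d : ℕ) : ℝ≥0∞) ^ (q - 1) * momentSum (μ.map f) q ρ := by
  choose S hS hS' using h.exists_finset (r := r) hρ
  rw [momentSum_eq_tsum_rows μ hf q r hρ, momentSum_map_eq_tsum_columns μ hf q ρ hr]
  exact tsum_rpow_rows_le _ S _ hS (fun k l hl => measure_mono_null (hS' k l hl) hB) hq

theorem OscBound.momentSum_map_le (h : OscBound f B r ρ m) (hf : Measurable f) (hB : μ Bᶜ = 0)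
    (hr : 0 < r) (hρ : 0 < ρ) (hq : 0 < q) (hq1 : q ≤ 1) :
    momentSum (μ.map f) q ρ ≤ (((2 * m + 1) ^ d : ℕ) : ℝ≥0∞) ^ (1 - q) * momentSum μ q r := by
  choose S hS hS' using h.exists_finset (r := r) hρ
  rw [momentSum_eq_tsum_rows μ hf q r hρ, momentSum_map_eq_tsum_columns μ hf q ρ hr]
  exact tsum_rpow_columns_le _ S _ hS (fun k l hl => measure_mono_null (hS' k l hl) hB) hq hq1

end Comparison

section Bounded

variable {d : ℕ} {ν : Measure (EuclideanSpace ℝ (Fin d))} {R ρ q : ℝ} {m : ℕ}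

theorem measure_meshCube_eq_zero (hν : ν {x | ∀ j, |x j| ≤ R}ᶜ = 0) (hρ : 0 < ρ)
    (hm : R ≤ m * ρ) {l : Fin d → ℤ}
    (hl : l ∉ Fintype.piFinset fun _ : Fin d => Finset.Icc (-(m : ℤ)) m) :
    ν (meshCube ρ l) = 0 := by
  refine measure_mono_null (Set.subset_compl_iff_disjoint_right.2 <| Set.disjoint_left.2
    fun x hx hxR => hl (Fintype.mem_piFinset.2 fun j => ?_)) hν
  rw [← (mem_meshCube_iff hρ).1 hx j, Finset.mem_Icc]
  have h1 := abs_le.1 (hxR j)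
  constructor
  · rw [Int.le_floor, le_div_iff₀ hρ]; push_cast; nlinarith
  · have : x j / ρ ≤ (m : ℤ) := by rw [div_le_iff₀ hρ]; push_cast; linarith
    simpa using Int.floor_le_floor this

theorem card_piFinset_Icc_neg (d m : ℕ) :
    (Fintype.piFinset fun _ : Fin d => Finset.Icc (-(m : ℤ)) m).card = (2 * m + 1) ^ d := by
  rw [Fintype.card_piFinset]
  simp only [Int.card_Icc, Finset.prod_const, Finset.card_univ, Fintype.card_fin]
  congr 1; omega

theorem tsum_measure_meshCube [IsProbabilityMeasure ν] (hρ : 0 < ρ) :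
    ∑' l : Fin d → ℤ, ν (meshCube ρ l) = 1 := by
  simpa using tsum_measure_inter_meshCube ν measurable_id hρ MeasurableSet.univ

/-- `tsum_rpow_rows_le` for the array whose only row lists the masses of the mesh cubes. -/
theorem one_le_momentSum [IsProbabilityMeasure ν] (hν : ν {x | ∀ j, |x j| ≤ R}ᶜ = 0)
    (hρ : 0 < ρ) (hm : R ≤ m * ρ) (hq : 1 ≤ q) :
    1 ≤ (((2 * m + 1) ^ d : ℕ) : ℝ≥0∞) ^ (q - 1) * momentSum ν q ρ := by
  have := tsum_rpow_rows_le (fun (_ : Unit) l => ν (meshCube ρ l)) _ _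
    (fun _ => (card_piFinset_Icc_neg d m).le)
    (fun _ l hl => measure_meshCube_eq_zero hν hρ hm hl) hq
  simpa [tsum_measure_meshCube hρ, momentSum] using this

theorem momentSum_le_of_bounded [IsProbabilityMeasure ν] (hν : ν {x | ∀ j, |x j| ≤ R}ᶜ = 0)
    (hρ : 0 < ρ) (hm : R ≤ m * ρ) (hq : 0 < q) (hq1 : q ≤ 1) :
    momentSum ν q ρ ≤ (((2 * m + 1) ^ d : ℕ) : ℝ≥0∞) ^ (1 - q) := by
  have := tsum_rpow_columns_le (fun (_ : Unit) l => ν (meshCube ρ l)) _ _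
    (fun _ => (card_piFinset_Icc_neg d m).le)
    (fun _ l hl => measure_meshCube_eq_zero hν hρ hm hl) hq hq1
  simpa [tsum_measure_meshCube hρ, momentSum] using this

end Bounded

/-! ### Bounds for the dimension quotient -/

theorem dimQuotient_le_iff_of_one_lt {n : ℕ} {ν : Measure (EuclideanSpace ℝ (Fin n))} {q r : ℝ}
    (hq : 1 < q) (hr : 0 < r) (hr1 : r < 1) (L : ℝ) :
    dimQuotient ν q r ≤ L ↔ ENNReal.ofReal (r ^ (L * (q - 1))) ≤ momentSum ν q r := by
  have hc : (q - 1) * Real.log r < 0 := mul_neg_of_pos_of_neg (by linarith) (Real.log_neg hr hr1)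
  have hp : 0 < r ^ (L * (q - 1)) := Real.rpow_pos_of_pos hr _
  rw [← ENNReal.log_le_log_iff, ENNReal.log_ofReal_of_pos hp, Real.log_rpow hr, dimQuotient]
  generalize ENNReal.log (momentSum ν q r) = a
  induction a with
  | bot =>
    rw [EReal.bot_div_of_neg_ne_bot (by exact_mod_cast hc) (EReal.coe_ne_bot _)]
    exact iff_of_false (not_le.2 (EReal.coe_lt_top _)) (not_le.2 (EReal.bot_lt_coe _))
  | top => rw [EReal.top_div_of_neg_ne_bot (by exact_mod_cast hc) (EReal.coe_ne_bot _)]; simp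
  | coe x =>
    rw [← EReal.coe_div, EReal.coe_le_coe_iff, EReal.coe_le_coe_iff, div_le_iff_of_neg hc, mul_assoc]

theorem dimQuotient_le_iff_of_lt_one {n : ℕ} {ν : Measure (EuclideanSpace ℝ (Fin n))} {q r : ℝ}
    (hq : q < 1) (hr : 0 < r) (hr1 : r < 1) (L : ℝ) :
    dimQuotient ν q r ≤ L ↔ momentSum ν q r ≤ ENNReal.ofReal (r ^ (L * (q - 1))) := by
  have hc : 0 < (q - 1) * Real.log r := mul_pos_of_neg_of_neg (by linarith) (Real.log_neg hr hr1)
  have hp : 0 < r ^ (L * (q - 1)) := Real.rpow_pos_of_pos hr _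
  rw [← ENNReal.log_le_log_iff, ENNReal.log_ofReal_of_pos hp, Real.log_rpow hr, dimQuotient,
    EReal.div_le_iff_le_mul (by exact_mod_cast hc) (EReal.coe_ne_top _), ← EReal.coe_mul]
  rw [show (q - 1) * Real.log r * L = L * (q - 1) * Real.log r by ring]

/-- A lower bound `t ^ (q - 1)` for the moment sum if `q > 1`, and the reversed bound if `q < 1`,
up to the factor `K ^ |q - 1|`, bounds the dimension quotient as soon as `K ρ ^ L ≤ t`. -/
theorem dimQuotient_le_of_momentSum {n : ℕ} {ν : Measure (EuclideanSpace ℝ (Fin n))}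
    {q ρ t L : ℝ} {K : ℕ} (hq1 : q ≠ 1) (hρ : 0 < ρ) (hρ1 : ρ < 1) (hK : 0 < K)
    (hgt : 1 < q → ENNReal.ofReal (t ^ (q - 1)) ≤ (K : ℝ≥0∞) ^ (q - 1) * momentSum ν q ρ)
    (hlt : q < 1 → momentSum ν q ρ ≤ (K : ℝ≥0∞) ^ (1 - q) * ENNReal.ofReal (t ^ (q - 1)))
    (hsmall : K * ρ ^ L ≤ t) : dimQuotient ν q ρ ≤ L := by
  have hK' : (0 : ℝ) < K := by exact_mod_cast hK
  have hKc : ∀ s : ℝ, (K : ℝ≥0∞) ^ s = ENNReal.ofReal ((K : ℝ) ^ s) := fun s => by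
    rw [← ENNReal.ofReal_rpow_of_pos hK', ENNReal.ofReal_natCast]
  have hL : 0 < ρ ^ L := Real.rpow_pos_of_pos hρ _
  rcases lt_or_gt_of_ne hq1 with h | h
  · rw [dimQuotient_le_iff_of_lt_one h hρ hρ1]
    refine (hlt h).trans ?_
    rw [hKc, ← ENNReal.ofReal_mul (by positivity)]
    refine ENNReal.ofReal_le_ofReal ?_
    rw [Real.rpow_mul hρ.le]
    have h1 : t ^ (q - 1) ≤ (K * ρ ^ L) ^ (q - 1) :=
      Real.rpow_le_rpow_of_nonpos (by positivity) hsmall (by linarith)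
    calc (K : ℝ) ^ (1 - q) * t ^ (q - 1) ≤ (K : ℝ) ^ (1 - q) * (K * ρ ^ L) ^ (q - 1) := by gcongr
      _ = (ρ ^ L) ^ (q - 1) := by
        rw [Real.mul_rpow hK'.le hL.le, ← mul_assoc, ← Real.rpow_add hK']; simp
  · rw [dimQuotient_le_iff_of_one_lt h hρ hρ1]
    have h1 : (K * ρ ^ L) ^ (q - 1) ≤ t ^ (q - 1) :=
      Real.rpow_le_rpow (by positivity) hsmall (by linarith)
    have h2 := (ENNReal.ofReal_le_ofReal h1).trans (hgt h)
    rw [Real.mul_rpow hK'.le hL.le, ENNReal.ofReal_mul (by positivity), ← hKc,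
      ← Real.rpow_mul hρ.le] at h2
    refine (ENNReal.mul_le_mul_iff_right ?_ ?_).1 h2
    · rw [hKc]; simpa using Real.rpow_pos_of_pos hK' _
    · rw [hKc]; exact ENNReal.ofReal_ne_top

/-- An oscillation bound at scales `r` and `r ^ β` transfers a bound `L` for the dimension quotient
at scale `r` to a bound `L'` for the image at scale `r ^ β`, where `L < β L'`. -/
theorem OscBound.dimQuotient_map_le {n d : ℕ} {μ : Measure (EuclideanSpace ℝ (Fin n))}
    {f : EuclideanSpace ℝ (Fin n) → EuclideanSpace ℝ (Fin d)} {B : Set (EuclideanSpace ℝ (Fin n))}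
    {r β q L L' : ℝ} {m : ℕ} (h : OscBound f B r (r ^ β) m) (hf : Measurable f) (hB : μ Bᶜ = 0)
    (hr : 0 < r) (hr1 : r < 1) (hβ : 0 < β) (hq : 0 < q) (hq1 : q ≠ 1)
    (hsmall : ((2 * m + 1) ^ d : ℕ) * r ^ (β * L' - L) ≤ 1) (hL : dimQuotient μ q r ≤ L) :
    dimQuotient (μ.map f) q (r ^ β) ≤ L' := by
  have hρ : 0 < r ^ β := Real.rpow_pos_of_pos hr β
  refine dimQuotient_le_of_momentSum (t := r ^ L) (K := (2 * m + 1) ^ d) hq1 hρ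
    (Real.rpow_lt_one hr.le hr1 hβ) (by positivity) ?_ ?_ ?_
  · intro hq'
    rw [← Real.rpow_mul hr.le]
    exact ((dimQuotient_le_iff_of_one_lt hq' hr hr1 L).1 hL).trans
      (h.momentSum_le hf hB hr hρ hq'.le)
  · intro hq'
    rw [← Real.rpow_mul hr.le]
    refine (h.momentSum_map_le hf hB hr hρ hq hq'.le).trans ?_
    gcongr
    exact (dimQuotient_le_iff_of_lt_one hq' hr hr1 L).1 hL
  · rw [Real.rpow_sub hr, ← mul_div_assoc, div_le_one (Real.rpow_pos_of_pos hr L)] at hsmall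
    rwa [← Real.rpow_mul hr.le]

theorem eventually_nhdsGT_mem_Ioo {a : ℝ} (ha : 0 < a) : ∀ᶠ r in 𝓝[>] (0 : ℝ), 0 < r ∧ r < a :=
  Ioo_mem_nhdsGT ha

theorem tendsto_rpow_nhdsGT_zero {s : ℝ} (hs : 0 < s) :
    Tendsto (fun r : ℝ => r ^ s) (𝓝[>] 0) (𝓝[>] 0) := by
  refine tendsto_nhdsWithin_iff.2 ⟨?_, ?_⟩
  · have := (Real.continuousAt_rpow_const 0 s (Or.inr hs.le)).tendsto
    rw [Real.zero_rpow hs.ne'] at this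
    exact this.mono_left nhdsWithin_le_nhds
  · filter_upwards [self_mem_nhdsWithin] with r hr using Real.rpow_pos_of_pos hr s

theorem eventually_mul_rpow_le {s c : ℝ} (K : ℝ) (hs : 0 < s) (hc : 0 < c) :
    ∀ᶠ r in 𝓝[>] (0 : ℝ), K * r ^ s ≤ c := by
  have := ((tendsto_rpow_nhdsGT_zero hs).mono_right nhdsWithin_le_nhds).const_mul K
  rw [mul_zero] at this
  exact (this.eventually (gt_mem_nhds hc)).mono fun _ h => h.le

section Image

variable {n d : ℕ} {μ : Measure (EuclideanSpace ℝ (Fin n))}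
  {f : EuclideanSpace ℝ (Fin n) → EuclideanSpace ℝ (Fin d)} {B : Set (EuclideanSpace ℝ (Fin n))}
  {β q L L' : ℝ} {m : ℕ}

/-- At small scales the constant `(2 m + 1) ^ d` is absorbed by the gap between `L` and `β L'`. -/
theorem eventually_dimQuotient_map_le (hf : Measurable f) (hB : μ Bᶜ = 0) (hβ : 0 < β)
    (hq : 0 < q) (hq1 : q ≠ 1) (hLL : L < β * L') :
    ∀ᶠ r in 𝓝[>] (0 : ℝ), OscBound f B r (r ^ β) m → dimQuotient μ q r ≤ L →
      dimQuotient (μ.map f) q (r ^ β) ≤ L' := by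
  filter_upwards [eventually_nhdsGT_mem_Ioo one_pos,
    eventually_mul_rpow_le (((2 * m + 1) ^ d : ℕ) : ℝ) (sub_pos.2 hLL) one_pos]
    with r hr hs h hL
  exact h.dimQuotient_map_le hf hB hr.1 hr.2 hβ hq hq1 hs hL

theorem lowerDim_map_le_of_frequently (hf : Measurable f) (hB : μ Bᶜ = 0) (hβ : 0 < β)
    (hq : 0 < q) (hq1 : q ≠ 1) (hLL : L < β * L')
    (h : ∃ᶠ r in 𝓝[>] (0 : ℝ), OscBound f B r (r ^ β) m ∧ dimQuotient μ q r ≤ L) :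
    lowerDim q (μ.map f) ≤ L' := by
  have h1 : ∃ᶠ r in 𝓝[>] (0 : ℝ), dimQuotient (μ.map f) q (r ^ β) ≤ L' :=
    (h.and_eventually (eventually_dimQuotient_map_le hf hB hβ hq hq1 hLL)).mono
      fun r hr => hr.2 hr.1.1 hr.1.2
  exact liminf_le_of_frequently_le' ((tendsto_rpow_nhdsGT_zero hβ).frequently h1)

theorem lowerDim_map_le (hf : Measurable f) (hB : μ Bᶜ = 0) (hβ : 0 < β)
    (hq : 0 < q) (hq1 : q ≠ 1) (hLL : L < β * L') (hL : lowerDim q μ < L)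
    (h : ∀ᶠ r in 𝓝[>] (0 : ℝ), OscBound f B r (r ^ β) m) :
    lowerDim q (μ.map f) ≤ L' := by
  refine lowerDim_map_le_of_frequently (m := m) hf hB hβ hq hq1 hLL ?_
  exact ((frequently_lt_of_liminf_lt (by isBoundedDefault) hL).and_eventually h).mono
    fun r hr => ⟨hr.2, hr.1.le⟩

theorem lowerDim_map_le_of_upperDim (hf : Measurable f) (hB : μ Bᶜ = 0) (hβ : 0 < β)
    (hq : 0 < q) (hq1 : q ≠ 1) (hLL : L < β * L') (hL : upperDim q μ < L)
    (h : ∃ᶠ r in 𝓝[>] (0 : ℝ), OscBound f B r (r ^ β) m) :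
    lowerDim q (μ.map f) ≤ L' := by
  refine lowerDim_map_le_of_frequently (m := m) hf hB hβ hq hq1 hLL ?_
  exact (h.and_eventually (eventually_lt_of_limsup_lt hL (by isBoundedDefault))).mono
    fun r hr => ⟨hr.1, hr.2.le⟩

theorem upperDim_map_le (hf : Measurable f) (hB : μ Bᶜ = 0) (hβ : 0 < β)
    (hq : 0 < q) (hq1 : q ≠ 1) (hLL : L < β * L') (hL : upperDim q μ < L)
    (h : ∀ᶠ r in 𝓝[>] (0 : ℝ), OscBound f B r (r ^ β) m) :
    upperDim q (μ.map f) ≤ L' := by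
  have h1 : ∀ᶠ r in 𝓝[>] (0 : ℝ), dimQuotient (μ.map f) q (r ^ β) ≤ L' := by
    filter_upwards [h, eventually_lt_of_limsup_lt hL (by isBoundedDefault),
      eventually_dimQuotient_map_le (m := m) hf hB hβ hq hq1 hLL] with r h1 h2 h3
    exact h3 h1 h2.le
  refine limsup_le_of_le (by isBoundedDefault) ?_
  filter_upwards [(tendsto_rpow_nhdsGT_zero (inv_pos.2 hβ)).eventually h1, self_mem_nhdsWithin]
    with r hr hr0
  rwa [Real.rpow_inv_rpow (le_of_lt hr0) hβ.ne'] at hr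

end Image

/-- A probability measure on a bounded subset of `ℝᵈ` has upper dimension at most `d`: a mesh of
side `r` has `O(r ^ (-d))` cubes of positive measure. -/
theorem upperDim_le_of_bounded {d : ℕ} {ν : Measure (EuclideanSpace ℝ (Fin d))}
    [IsProbabilityMeasure ν] {R q : ℝ} (hR : 0 ≤ R) (hν : ν {x | ∀ j, |x j| ≤ R}ᶜ = 0)
    (hq : 0 < q) (hq1 : q ≠ 1) : upperDim q ν ≤ d := by
  refine EReal.le_of_forall_lt_iff_le.1 fun L hL => ?_
  have hL : (d : ℝ) < L := by exact_mod_cast hL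
  refine limsup_le_of_le (by isBoundedDefault) ?_
  filter_upwards [eventually_nhdsGT_mem_Ioo one_pos,
    eventually_mul_rpow_le ((2 * R + 3) ^ d) (sub_pos.2 hL) one_pos] with r hr hs
  have hm : R ≤ ⌈R / r⌉₊ * r := by
    rw [← div_le_iff₀ hr.1]; exact Nat.le_ceil _
  have hm' : (2 * ⌈R / r⌉₊ + 1 : ℝ) ≤ (2 * R + 3) / r := by
    have h1 := (Nat.ceil_lt_add_one (div_nonneg hR hr.1.le)).le
    have h2 : (1 : ℝ) ≤ 1 / r := by rw [le_div_iff₀ hr.1]; linarith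
    calc (2 * ⌈R / r⌉₊ + 1 : ℝ) ≤ 2 * (R / r) + 3 * (1 / r) := by linarith
      _ = _ := by ring
  refine dimQuotient_le_of_momentSum (t := 1) (K := (2 * ⌈R / r⌉₊ + 1) ^ d) hq1 hr.1 hr.2
    (by positivity) ?_ ?_ ?_
  · intro hq'
    simpa using one_le_momentSum hν hr.1 hm hq'.le
  · intro hq'
    simpa using momentSum_le_of_bounded hν hr.1 hm hq hq'.le
  · refine le_trans ?_ hs
    push_cast
    rw [Real.rpow_sub hr.1, Real.rpow_natCast]
    calc (2 * ⌈R / r⌉₊ + 1 : ℝ) ^ d * r ^ L ≤ ((2 * R + 3) / r) ^ d * r ^ L := by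
          have := Real.rpow_pos_of_pos hr.1 L
          gcongr
      _ = _ := by rw [div_pow]; ring

theorem lowerDim_le_upperDim {n : ℕ} (q : ℝ) (ν : Measure (EuclideanSpace ℝ (Fin n))) :
    lowerDim q ν ≤ upperDim q ν :=
  liminf_le_limsup

/-- To bound `b` by `a / α` it suffices to bound it by every real `L'` with `L < β L'` for some
`L > a` and some rational `β ∈ (0, α)`. -/
theorem le_inv_mul_of_forall {a b : EReal} {α : ℝ} (hα : 0 < α)
    (h : ∀ (β : ℚ) (L L' : ℝ), 0 < (β : ℝ) → (β : ℝ) < α → a < L → L < β * L' → b ≤ L') :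
    b ≤ ((1 / α : ℝ) : EReal) * a := by
  have hα' : 0 < 1 / α := by positivity
  induction a with
  | top => rw [EReal.coe_mul_top_of_pos hα']; exact le_top
  | bot =>
    rw [EReal.coe_mul_bot_of_pos hα']
    refine EReal.le_of_forall_lt_iff_le.1 fun L' _ => ?_
    obtain ⟨β, hβ1, hβ2⟩ := exists_rat_btwn hα
    exact h β (β * L' - 1) L' hβ1 hβ2 (EReal.bot_lt_coe _) (by linarith)
  | coe a =>
    refine EReal.le_of_forall_lt_iff_le.1 fun L' hL' => ?_
    have hL' : a < α * L' := by
      rw [← EReal.coe_mul, EReal.coe_lt_coe_iff, one_div_mul_eq_div, div_lt_iff₀ hα] at hL'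
      linarith
    have h1 : ∀ᶠ β in 𝓝[<] α, a < β * L' :=
      nhdsWithin_le_nhds ((continuous_mul_const L').continuousAt.eventually (lt_mem_nhds hL'))
    obtain ⟨l, hl, hl'⟩ := (mem_nhdsLT_iff_exists_Ioo_subset).1 (h1.and (Ioo_mem_nhdsLT hα))
    obtain ⟨β, hβ1, hβ2⟩ := exists_rat_btwn (show l < α from hl)
    obtain ⟨hβ, hβ3, -⟩ := hl' ⟨hβ1, hβ2⟩
    obtain ⟨L, hL1, hL2⟩ := exists_between hβ
    exact h β L L' hβ3 hβ2 (by exact_mod_cast hL1) hL2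

/-! ### Gaussian increments -/

/-- A centred Gaussian variable is sub-Gaussian with any parameter `V` above its variance; the
degenerate case of variance `0` is included. -/
theorem hasSubgaussianMGF_of_hasGaussianLaw {Ω : Type*} [MeasurableSpace Ω] {P : Measure Ω}
    [IsProbabilityMeasure P] {Z : Ω → ℝ} (hZ : HasGaussianLaw Z P) (h0 : ∫ ω, Z ω ∂P = 0)
    {V : NNReal} (hV : ∫ ω, Z ω ^ 2 ∂P ≤ V) : HasSubgaussianMGF Z V P := by
  have hlaw := hZ.map_eq_gaussianReal
  rw [variance_of_integral_eq_zero hZ.aemeasurable h0, h0] at hlaw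
  refine ⟨fun t => ?_, fun t => ?_⟩
  · have h := integrable_exp_mul_gaussianReal (μ := 0) (v := (∫ ω, Z ω ^ 2 ∂P).toNNReal) t
    rw [← hlaw] at h
    exact (integrable_map_measure (by fun_prop) hZ.aemeasurable).1 h
  · rw [mgf_gaussianReal hlaw, zero_mul, zero_add]
    have : ((∫ ω, Z ω ^ 2 ∂P).toNNReal : ℝ) ≤ V := by
      exact_mod_cast Real.toNNReal_le_iff_le_coe.2 hV
    gcongr

theorem measure_le_abs_le_of_hasSubgaussianMGF {Ω : Type*} [MeasurableSpace Ω] {P : Measure Ω}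
    [IsProbabilityMeasure P] {Z : Ω → ℝ} {V : NNReal} (hZ : HasSubgaussianMGF Z V P) {t : ℝ}
    (ht : 0 ≤ t) : P {ω | t ≤ |Z ω|} ≤ ENNReal.ofReal (2 * Real.exp (-t ^ 2 / (2 * V))) := by
  have h1 := hZ.measure_ge_le ht
  have h2 := hZ.neg.measure_ge_le ht
  have hsub : {ω | t ≤ |Z ω|} ⊆ {ω | t ≤ Z ω} ∪ {ω | t ≤ (-Z) ω} := fun ω hω => le_abs (a := t).1 hω
  refine (measure_mono hsub).trans ((measure_union_le _ _).trans ?_)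
  rw [two_mul, ENNReal.ofReal_add (Real.exp_nonneg _) (Real.exp_nonneg _)]
  rw [Measure.real, ← ENNReal.le_ofReal_iff_toReal_le (measure_ne_top _ _) (Real.exp_nonneg _)]
    at h1 h2
  exact add_le_add h1 h2

/-- The tail of a coordinate increment of `X`, whose law is that of the increment of `X₀`. -/
theorem measure_le_abs_increment_le {N d : ℕ} {Ω₀ Ω : Type*} [MeasurableSpace Ω₀]
    [MeasurableSpace Ω] {P₀ : Measure Ω₀} [IsProbabilityMeasure P₀] {P : Measure Ω}
    [IsProbabilityMeasure P] {X₀ : EuclideanSpace ℝ (Fin N) → Ω₀ → ℝ}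
    (hX₀ : IsCenteredGaussianField P₀ X₀)
    {X : EuclideanSpace ℝ (Fin N) → Ω → EuclideanSpace ℝ (Fin d)}
    (hX : IsFieldOfIndepCopies P₀ X₀ P X) (j : Fin d) (x y : EuclideanSpace ℝ (Fin N)) {V t : ℝ}
    (hV : ∫ ω, (X₀ y ω - X₀ x ω) ^ 2 ∂P₀ ≤ V) (ht : 0 ≤ t) :
    P {ω | t ≤ |X y ω j - X x ω j|} ≤ ENNReal.ofReal (2 * Real.exp (-t ^ 2 / (2 * V))) := by
  classical
  have hV0 : 0 ≤ V := le_trans (integral_nonneg fun ω => sq_nonneg _) hV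
  lift V to NNReal using hV0
  have hint : ∀ x, Integrable (X₀ x) P₀ := fun x => (hX₀.gaussian.hasGaussianLaw_eval x).integrable
  have h0 : HasSubgaussianMGF (fun ω => X₀ y ω - X₀ x ω) V P₀ :=
    hasSubgaussianMGF_of_hasGaussianLaw hX₀.gaussian.hasGaussianLaw_fun_sub
      (by rw [integral_sub (hint y) (hint x), hX₀.mean_zero, hX₀.mean_zero, sub_zero]) hV
  have hid := (hX.copies j {x, y}).comp
    (u := fun g : ({x, y} : Finset (EuclideanSpace ℝ (Fin N))) → ℝ =>
      g ⟨y, by simp⟩ - g ⟨x, by simp⟩) (by fun_prop)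
  exact measure_le_abs_le_of_hasSubgaussianMGF (h0.congr_identDistrib hid.symm) ht

/-! ### Increments over a grid -/

/-- The point of the lattice `s ℤⁿ` with index `k`. -/
def gridPoint {n : ℕ} (s : ℝ) (k : Fin n → ℤ) : EuclideanSpace ℝ (Fin n) :=
  WithLp.toLp 2 fun i => k i * s

@[simp] theorem gridPoint_apply {n : ℕ} (s : ℝ) (k : Fin n → ℤ) (i : Fin n) :
    gridPoint s k i = k i * s := rfl

/-- The cube of points with all coordinates in `[-R, R]`. -/
def box (n : ℕ) (R : ℝ) : Set (EuclideanSpace ℝ (Fin n)) := {x | ∀ i, |x i| ≤ R}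

/-- The function `y` changes by at most `a` between points of the lattice `s ℤⁿ` in `box n R` whose
coordinates differ by at most `3 r`. -/
def GridBound {n : ℕ} (y : EuclideanSpace ℝ (Fin n) → ℝ) (R s r a : ℝ) : Prop :=
  ∀ k l : Fin n → ℤ, gridPoint s k ∈ box n R → gridPoint s l ∈ box n R →
    (∀ i, |gridPoint s k i - gridPoint s l i| ≤ 3 * r) → |y (gridPoint s k) - y (gridPoint s l)| ≤ a

theorem mem_piFinset_of_gridPoint_mem_box {n : ℕ} {s R : ℝ} (hs : 0 < s) {k : Fin n → ℤ}
    (hk : gridPoint s k ∈ box n R) :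
    k ∈ Fintype.piFinset fun _ : Fin n => Finset.Icc (-(⌈R / s⌉₊ : ℤ)) ⌈R / s⌉₊ := by
  refine Fintype.mem_piFinset.2 fun i => ?_
  have h := hk i
  rw [gridPoint_apply, abs_mul, abs_of_pos hs, ← le_div_iff₀ hs] at h
  have h' : ((|k i| : ℤ) : ℝ) ≤ ((⌈R / s⌉₊ : ℤ) : ℝ) := by
    push_cast; exact h.trans (Nat.le_ceil _)
  rw [Finset.mem_Icc, ← abs_le]
  exact_mod_cast h'

/-- Polynomially many events of probability `≤ 2 exp (- r ^ (-e) / (2 M))` have total probability at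
most `r`, for small `r`. -/
theorem eventually_rpow_mul_exp_le {C M p e : ℝ} (hM : 0 < M) (he : 0 < e) :
    ∀ᶠ r in 𝓝[>] (0 : ℝ), C * r ^ (-p) * (2 * Real.exp (-r ^ (-e) / (2 * M))) ≤ r := by
  have h1 := (tendsto_rpow_mul_exp_neg_mul_atTop_nhds_zero ((p + 1) / e) (1 / (2 * M))
    (by positivity)).comp (tendsto_rpow_neg_nhdsGT_zero (neg_neg_of_pos he))
  have h2 := h1.const_mul (2 * C)
  rw [mul_zero] at h2
  filter_upwards [h2.eventually (gt_mem_nhds one_pos), self_mem_nhdsWithin] with r hr hr0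
  have hr0 : 0 < r := hr0
  simp only [Function.comp_apply] at hr
  rw [← Real.rpow_mul hr0.le, neg_mul, mul_div_cancel₀ _ he.ne', neg_add, Real.rpow_add hr0,
    Real.rpow_neg_one] at hr
  have := mul_le_mul_of_nonneg_right hr.le hr0.le
  rw [one_mul] at this
  refine le_trans (le_of_eq ?_) this
  rw [show -(1 / (2 * M)) * r ^ (-e) = -r ^ (-e) / (2 * M) by ring]
  field_simp

section Grid

variable {N : ℕ} {Ω : Type*} [MeasurableSpace Ω] {P : Measure Ω}
  {Y : EuclideanSpace ℝ (Fin N) → Ω → ℝ}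

/-- Union bound over the pairs of lattice points in the box. -/
theorem measure_not_gridBound_le {R s r a b : ℝ} (hs : 0 < s) (hs1 : s ≤ 1) (hR : 0 ≤ R)
    (hb : 0 ≤ b)
    (h : ∀ x y : EuclideanSpace ℝ (Fin N), (∀ i, |x i - y i| ≤ 3 * r) →
      P {ω | a ≤ |Y x ω - Y y ω|} ≤ ENNReal.ofReal b) :
    P {ω | ¬ GridBound (fun x => Y x ω) R s r a} ≤
      ENNReal.ofReal ((((2 * R + 3) / s) ^ N) ^ 2 * b) := by
  classical
  set F := Fintype.piFinset fun _ : Fin N => Finset.Icc (-(⌈R / s⌉₊ : ℤ)) ⌈R / s⌉₊ with hF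
  set T := (F ×ˢ F).filter fun p => ∀ i, |gridPoint s p.1 i - gridPoint s p.2 i| ≤ 3 * r with hT
  have hsub : {ω | ¬ GridBound (fun x => Y x ω) R s r a} ⊆
      ⋃ p ∈ T, {ω | a ≤ |Y (gridPoint s p.1) ω - Y (gridPoint s p.2) ω|} := by
    intro ω hω
    simp only [GridBound, Set.mem_ofPred_eq, not_forall, not_le] at hω
    obtain ⟨k, l, hk, hl, hkl, hlt⟩ := hω
    refine Set.mem_iUnion₂.2 ⟨(k, l), ?_, hlt.le⟩
    exact Finset.mem_filter.2 ⟨Finset.mem_product.2 ⟨mem_piFinset_of_gridPoint_mem_box hs hk,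
      mem_piFinset_of_gridPoint_mem_box hs hl⟩, hkl⟩
  have hcard : (T.card : ℝ) ≤ (((2 * R + 3) / s) ^ N) ^ 2 := by
    have h1 : T.card ≤ ((2 * ⌈R / s⌉₊ + 1) ^ N) ^ 2 := by
      refine (Finset.card_filter_le _ _).trans ?_
      rw [Finset.card_product, hF, card_piFinset_Icc_neg, sq]
    have h2 : (2 * ⌈R / s⌉₊ + 1 : ℝ) ≤ (2 * R + 3) / s := by
      have h1 := (Nat.ceil_lt_add_one (div_nonneg hR hs.le)).le
      have h2 : (1 : ℝ) ≤ 1 / s := by rw [le_div_iff₀ hs]; linarith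
      calc (2 * ⌈R / s⌉₊ + 1 : ℝ) ≤ 2 * (R / s) + 3 * (1 / s) := by linarith
        _ = _ := by ring
    calc (T.card : ℝ) ≤ (((2 * ⌈R / s⌉₊ + 1) ^ N) ^ 2 : ℕ) := by exact_mod_cast h1
      _ = ((2 * ⌈R / s⌉₊ + 1 : ℝ) ^ N) ^ 2 := by push_cast; rfl
      _ ≤ _ := by gcongr
  calc P {ω | ¬ GridBound (fun x => Y x ω) R s r a}
      ≤ P (⋃ p ∈ T, {ω | a ≤ |Y (gridPoint s p.1) ω - Y (gridPoint s p.2) ω|}) := measure_mono hsub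
    _ ≤ ∑ p ∈ T, P {ω | a ≤ |Y (gridPoint s p.1) ω - Y (gridPoint s p.2) ω|} :=
        measure_biUnion_finset_le _ _
    _ ≤ ∑ p ∈ T, ENNReal.ofReal b :=
        Finset.sum_le_sum fun p hp => h _ _ (Finset.mem_filter.1 hp).2
    _ = ENNReal.ofReal (T.card * b) := by
        rw [Finset.sum_const, nsmul_eq_mul, ENNReal.ofReal_mul (by positivity),
          ENNReal.ofReal_natCast]
    _ ≤ _ := by gcongr

/-- Along scales `r n ≤ 2 ^ (-n)` at which increments have Gaussian tails of variance
`M r ^ (2 β)`, almost surely all increments at these scales over a polynomially fine grid are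
eventually at most `r ^ β'`, for any `β' < β`. -/
theorem ae_eventually_gridBound {r : ℕ → ℝ} (hr : ∀ n, 0 < r n) (hr2 : ∀ n, r n ≤ (1 / 2) ^ n)
    {κ R M β β' : ℝ} (hκ : 0 ≤ κ) (hR : 0 ≤ R) (hM : 0 < M) (hβ : β' < β)
    (htail : ∀ᶠ n in atTop, ∀ x y : EuclideanSpace ℝ (Fin N), (∀ i, |x i - y i| ≤ 3 * r n) →
      ∀ t : ℝ, 0 ≤ t → P {ω | t ≤ |Y x ω - Y y ω|} ≤
        ENNReal.ofReal (2 * Real.exp (-t ^ 2 / (2 * (M * r n ^ (2 * β)))))) :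
    ∀ᵐ ω ∂P, ∀ᶠ n in atTop, GridBound (fun x => Y x ω) R (r n ^ κ) (r n) (r n ^ β') := by
  have hr0 : Tendsto r atTop (𝓝[>] 0) :=
    tendsto_nhdsWithin_iff.2 ⟨squeeze_zero (fun n => (hr n).le) hr2
      (tendsto_pow_atTop_nhds_zero_of_lt_one (by norm_num) (by norm_num)),
      Eventually.of_forall hr⟩
  set A : ℕ → Set Ω := fun n =>
    {ω | ¬ GridBound (fun x => Y x ω) R (r n ^ κ) (r n) (r n ^ β')} with hA
  have hbound : ∀ᶠ n in atTop, P (A n) ≤ ENNReal.ofReal ((1 / 2) ^ n) := by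
    filter_upwards [htail, hr0.eventually (eventually_rpow_mul_exp_le
      (C := ((2 * R + 3) ^ N) ^ 2) (p := κ * N * 2) hM (by linarith : 0 < 2 * (β - β')))]
      with n hn hsmall
    have h1 : r n ≤ 1 := (hr2 n).trans (pow_le_one₀ (by norm_num) (by norm_num))
    have hexp : -(r n ^ β') ^ 2 / (2 * (M * r n ^ (2 * β))) =
        -r n ^ (-(2 * (β - β'))) / (2 * M) := by
      have hsq : r n ^ (β' * 2) = (r n ^ β') ^ 2 := by rw [Real.rpow_mul (hr n).le, Real.rpow_two]
      rw [show -(2 * (β - β')) = β' * 2 - 2 * β by ring, Real.rpow_sub (hr n), hsq, ← neg_div,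
        div_div]
      congr 1; ring
    have hpow : (((2 * R + 3) / r n ^ κ) ^ N) ^ 2 =
        ((2 * R + 3) ^ N) ^ 2 * r n ^ (-(κ * N * 2)) := by
      rw [Real.rpow_neg (hr n).le, Real.rpow_mul (hr n).le, Real.rpow_mul (hr n).le,
        Real.rpow_natCast, div_pow, div_pow, div_eq_mul_inv]
      norm_cast
    refine (measure_not_gridBound_le (Real.rpow_pos_of_pos (hr n) κ)
      (Real.rpow_le_one (hr n).le h1 hκ) hR (by positivity)
      fun x y hxy => hn x y hxy _ (Real.rpow_nonneg (hr n).le β')).trans ?_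
    refine ENNReal.ofReal_le_ofReal ?_
    rw [hexp, hpow]
    exact hsmall.trans (hr2 n)
  -- The bound on `P (A n)` holds for large `n` only; the events for the other `n` are replaced by `∅`.
  have hsum : ∑' n, P {ω | P (A n) ≤ ENNReal.ofReal ((1 / 2) ^ n) ∧ ω ∈ A n} ≠ ∞ := by
    refine ne_top_of_le_ne_top (summable_geometric_two.tsum_ofReal_ne_top)
      (ENNReal.tsum_le_tsum fun n => ?_)
    by_cases h : P (A n) ≤ ENNReal.ofReal ((1 / 2) ^ n)
    · exact (measure_mono fun ω hω => hω.2).trans h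
    · exact (measure_mono_null (fun ω hω => (h hω.1).elim) measure_empty).trans_le zero_le
  filter_upwards [ae_eventually_notMem hsum] with ω hω
  filter_upwards [hω, hbound] with n h1 h2
  by_contra h3
  exact h1 ⟨h2, h3⟩

end Grid

/-! ### Chaining -/

/-- The lattice point of `s ℤⁿ` obtained by rounding down the coordinates. -/
noncomputable def floorPoint {n : ℕ} (s : ℝ) (x : EuclideanSpace ℝ (Fin n)) : EuclideanSpace ℝ (Fin n) :=
  gridPoint s fun i => ⌊x i / s⌋

section Floor

variable {n : ℕ} {s : ℝ} (x : EuclideanSpace ℝ (Fin n))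

theorem floorPoint_apply_le (hs : 0 < s) (i : Fin n) : floorPoint s x i ≤ x i :=
  (le_div_iff₀ hs).1 (Int.floor_le (x i / s))

theorem lt_floorPoint_apply_add (hs : 0 < s) (i : Fin n) : x i < floorPoint s x i + s := by
  have := (div_lt_iff₀ hs).1 (Int.lt_floor_add_one (x i / s))
  rw [add_mul, one_mul] at this
  exact this

theorem abs_sub_floorPoint_apply_le (hs : 0 < s) (i : Fin n) : |x i - floorPoint s x i| ≤ s := by
  have h1 := floorPoint_apply_le x hs i
  have h2 := lt_floorPoint_apply_add x hs i
  rw [abs_le]; constructor <;> linarith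

theorem floorPoint_mem_box {R : ℝ} (hs : 0 < s) (hs1 : s ≤ 1) {x : EuclideanSpace ℝ (Fin n)}
    (hx : x ∈ box n R) : floorPoint s x ∈ box n (R + 1) := by
  intro i
  have h1 := abs_sub_floorPoint_apply_le x hs i
  have h2 := hx i
  rw [abs_le] at *; constructor <;> linarith

theorem box_mono {R R' : ℝ} (h : R ≤ R') : box n R ⊆ box n R' := fun _ hx i => (hx i).trans h

theorem tendsto_floorPoint {s : ℕ → ℝ} (hs : ∀ m, 0 < s m) (hs0 : Tendsto s atTop (𝓝 0)) :
    Tendsto (fun m => floorPoint (s m) x) atTop (𝓝 x) := by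
  have : Tendsto (fun m => (WithLp.ofLp (floorPoint (s m) x))) atTop (𝓝 (WithLp.ofLp x)) := by
    refine tendsto_pi_nhds.2 fun i => tendsto_iff_dist_tendsto_zero.2 ?_
    refine squeeze_zero (fun _ => dist_nonneg) (fun m => ?_) hs0
    rw [dist_comm, Real.dist_eq]
    exact abs_sub_floorPoint_apply_le x (hs m) i
  exact ((PiLp.continuous_toLp 2 _).tendsto _).comp this

/-- A dyadic lattice point belongs to the next finer dyadic lattice. -/
theorem gridPoint_half_pow (m : ℕ) (k : Fin n → ℤ) :
    gridPoint ((1 / 2 : ℝ) ^ m) k = gridPoint ((1 / 2 : ℝ) ^ (m + 1)) fun i => 2 * k i := by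
  ext i
  simp only [gridPoint_apply]
  push_cast; ring

end Floor

section Chaining

variable {n : ℕ} {y : EuclideanSpace ℝ (Fin n) → ℝ} {R γ : ℝ}

/-- The roundings of `x` at levels `m` and `m + 1` are points of the finer lattice with coordinates
at distance at most `3 * 2 ^ (-(m + 1))`. -/
theorem abs_sub_floorPoint_succ_le {m : ℕ}
    (h : GridBound y (R + 1) ((1 / 2) ^ (m + 1)) ((1 / 2) ^ (m + 1)) (((1 / 2) ^ (m + 1)) ^ γ))
    {x : EuclideanSpace ℝ (Fin n)} (hx : x ∈ box n R) :
    |y (floorPoint ((1 / 2) ^ m) x) - y (floorPoint ((1 / 2) ^ (m + 1)) x)| ≤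
      ((1 / 2) ^ (m + 1)) ^ γ := by
  have hpos : ∀ m : ℕ, (0 : ℝ) < (1 / 2) ^ m := fun m => by positivity
  have hle : ∀ m : ℕ, (1 / 2 : ℝ) ^ m ≤ 1 := fun m => pow_le_one₀ (by norm_num) (by norm_num)
  have hbox := floorPoint_mem_box (hpos m) (hle m) hx
  have h1 := fun i => abs_sub_floorPoint_apply_le x (hpos m) i
  have h2 := fun i => abs_sub_floorPoint_apply_le x (hpos (m + 1)) i
  rw [floorPoint, gridPoint_half_pow] at hbox
  have h3 : floorPoint ((1 / 2 : ℝ) ^ m) x = gridPoint ((1 / 2 : ℝ) ^ (m + 1)) _ :=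
    gridPoint_half_pow m _
  rw [h3] at h1 ⊢
  refine h _ _ hbox (floorPoint_mem_box (hpos (m + 1)) (hle (m + 1)) hx) fun i => ?_
  refine (abs_sub_le _ (x i) _).trans ?_
  rw [abs_sub_comm _ (x i)]
  refine (add_le_add (h1 i) (h2 i)).trans (le_of_eq ?_)
  ring

/-- Summing the increments along the successive dyadic roundings of `x`. -/
theorem abs_sub_floorPoint_le (hy : Continuous y) (hγ : 0 < γ) {n₀ : ℕ}
    (h : ∀ m ≥ n₀, GridBound y (R + 1) ((1 / 2) ^ m) ((1 / 2) ^ m) (((1 / 2) ^ m) ^ γ))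
    {x : EuclideanSpace ℝ (Fin n)} (hx : x ∈ box n R) {m : ℕ} (hm : n₀ ≤ m) :
    |y x - y (floorPoint ((1 / 2) ^ m) x)| ≤
      ((1 / 2) ^ m) ^ γ * (1 - (1 / 2 : ℝ) ^ γ)⁻¹ := by
  have hθ : (1 / 2 : ℝ) ^ γ < 1 := Real.rpow_lt_one (by norm_num) (by norm_num) hγ
  have hlim : Tendsto (fun p => y (floorPoint ((1 / 2) ^ (m + p)) x)) atTop (𝓝 (y x)) := by
    refine (hy.tendsto x).comp (tendsto_floorPoint x (fun _ => by positivity) ?_)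
    simp only [add_comm m]
    exact (tendsto_add_atTop_iff_nat m).2
      (tendsto_pow_atTop_nhds_zero_of_lt_one (by norm_num) (by norm_num))
  have := dist_le_of_le_geometric_of_tendsto ((1 / 2 : ℝ) ^ γ) (((1 / 2) ^ m) ^ γ) hθ
    (fun p => ?_) hlim 0
  · rw [dist_comm, Real.dist_eq] at this
    simpa [div_eq_mul_inv] using this
  · rw [Real.dist_eq]
    refine (abs_sub_floorPoint_succ_le (h (m + p + 1) (by omega)) hx).trans ?_
    rw [Real.rpow_pow_comm (by norm_num),
      ← Real.mul_rpow (by positivity) (by positivity), ← pow_add]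
    refine Real.rpow_le_rpow (by positivity) ?_ hγ.le
    exact pow_le_pow_of_le_one (by norm_num) (by norm_num) (by omega)

/-- A continuous function whose dyadic increments at scale `2 ^ (-m)` are eventually at most
`2 ^ (-m γ)` is locally Hölder continuous of exponent `γ`. -/
theorem exists_holder_of_gridBound (hy : Continuous y) (hγ : 0 < γ)
    (h : ∀ᶠ m : ℕ in atTop,
      GridBound y (R + 1) ((1 / 2) ^ m) ((1 / 2) ^ m) (((1 / 2) ^ m) ^ γ)) :
    ∃ C : ℝ, ∀ᶠ r in 𝓝[>] (0 : ℝ), ∀ x ∈ box n R, ∀ x' ∈ box n R,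
      (∀ i, |x i - x' i| ≤ r) → |y x - y x'| ≤ C * r ^ γ := by
  obtain ⟨n₀, hn₀⟩ := eventually_atTop.1 h
  set D : ℝ := (1 - (1 / 2 : ℝ) ^ γ)⁻¹ with hD
  have hD0 : 0 < D := inv_pos.2 (sub_pos.2 (Real.rpow_lt_one (by norm_num) (by norm_num) hγ))
  refine ⟨(2 * D + 1) * 2 ^ γ, ?_⟩
  filter_upwards [eventually_nhdsGT_mem_Ioo (show (0 : ℝ) < (1 / 2) ^ n₀ by positivity)]
    with r hr x hx x' hx' hxx'
  have hr1 : r ≤ 1 := hr.2.le.trans (pow_le_one₀ (by norm_num) (by norm_num))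
  obtain ⟨m, hm1, hm2⟩ := exists_nat_pow_near_of_lt_one hr.1 hr1
    (by norm_num : (0 : ℝ) < 1 / 2) (by norm_num)
  have hm : n₀ ≤ m := by
    have := (pow_lt_pow_iff_right_of_lt_one₀ (by norm_num : (0 : ℝ) < 1 / 2) (by norm_num)).1
      (hm1.trans hr.2)
    omega
  have hpos : (0 : ℝ) < (1 / 2) ^ m := by positivity
  have hle : (1 / 2 : ℝ) ^ m ≤ 1 := pow_le_one₀ (by norm_num) (by norm_num)
  have h1 := abs_sub_floorPoint_le hy hγ hn₀ hx hm
  have h2 := abs_sub_floorPoint_le hy hγ hn₀ hx' hm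
  have h3 : |y (floorPoint ((1 / 2) ^ m) x) - y (floorPoint ((1 / 2) ^ m) x')| ≤
      ((1 / 2) ^ m) ^ γ := by
    refine hn₀ m hm _ _ (floorPoint_mem_box hpos hle hx) (floorPoint_mem_box hpos hle hx')
      fun i => ?_
    have e1 := abs_le.1 (abs_sub_floorPoint_apply_le x hpos i)
    have e2 := abs_le.1 (abs_sub_floorPoint_apply_le x' hpos i)
    have e3 := abs_le.1 (hxx' i)
    simp only [floorPoint] at e1 e2
    rw [abs_le]; constructor <;> linarith
  have h4 : ((1 / 2 : ℝ) ^ m) ^ γ ≤ 2 ^ γ * r ^ γ := by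
    rw [← Real.mul_rpow (by norm_num) hr.1.le]
    refine Real.rpow_le_rpow hpos.le ?_ hγ.le
    rw [pow_succ] at hm1; linarith
  calc |y x - y x'| ≤ |y x - y (floorPoint ((1 / 2) ^ m) x)| +
        |y (floorPoint ((1 / 2) ^ m) x) - y (floorPoint ((1 / 2) ^ m) x')| +
        |y x' - y (floorPoint ((1 / 2) ^ m) x')| := by
          rw [abs_sub_comm (y x')]
          exact (abs_sub_le _ (y (floorPoint ((1 / 2) ^ m) x')) _).trans
            (add_le_add (abs_sub_le _ _ _) le_rfl)
    _ ≤ (2 * D + 1) * ((1 / 2) ^ m) ^ γ := by linarith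
    _ ≤ (2 * D + 1) * (2 ^ γ * r ^ γ) := by gcongr
    _ = _ := by ring

/-- Increments over a distance `r` are controlled by increments between points of a lattice of mesh
`r ^ κ`, the rounding errors being controlled by Hölder continuity. -/
theorem abs_sub_le_of_gridBound {C κ β r : ℝ} (hr : 0 < r) (hr1 : r ≤ 1) (hκ : 1 ≤ κ)
    (hβ : β ≤ κ * γ) (hC : 0 ≤ C)
    (hhol : ∀ x ∈ box n (R + 1), ∀ x' ∈ box n (R + 1), (∀ i, |x i - x' i| ≤ r ^ κ) →
      |y x - y x'| ≤ C * (r ^ κ) ^ γ)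
    (hgrid : GridBound y (R + 1) (r ^ κ) r (r ^ β)) {x x' : EuclideanSpace ℝ (Fin n)}
    (hx : x ∈ box n R) (hx' : x' ∈ box n R) (hxx' : ∀ i, |x i - x' i| ≤ r) :
    |y x - y x'| ≤ (2 * C + 1) * r ^ β := by
  have hs : 0 < r ^ κ := Real.rpow_pos_of_pos hr κ
  have hsr : r ^ κ ≤ r := by
    simpa using Real.rpow_le_rpow_of_exponent_ge hr hr1 hκ
  have hs1 := hsr.trans hr1
  have hb := floorPoint_mem_box hs hs1 hx
  have hb' := floorPoint_mem_box hs hs1 hx'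
  have hmono := box_mono (n := n) (by linarith : R ≤ R + 1)
  have h1 := hhol _ (hmono hx) _ hb (abs_sub_floorPoint_apply_le x hs)
  have h2 := hhol _ (hmono hx') _ hb' (abs_sub_floorPoint_apply_le x' hs)
  have h3 : |y (floorPoint (r ^ κ) x) - y (floorPoint (r ^ κ) x')| ≤ r ^ β := by
    refine hgrid _ _ hb hb' fun i => ?_
    have e1 := abs_le.1 (abs_sub_floorPoint_apply_le x hs i)
    have e2 := abs_le.1 (abs_sub_floorPoint_apply_le x' hs i)
    have e3 := abs_le.1 (hxx' i)
    simp only [floorPoint] at e1 e2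
    rw [abs_le]; constructor <;> linarith
  have h4 : (r ^ κ) ^ γ ≤ r ^ β := by
    rw [← Real.rpow_mul hr.le]
    exact Real.rpow_le_rpow_of_exponent_ge hr hr1 hβ
  have h5 := mul_le_mul_of_nonneg_left h4 hC
  calc |y x - y x'| ≤ |y x - y (floorPoint (r ^ κ) x)| +
        |y (floorPoint (r ^ κ) x) - y (floorPoint (r ^ κ) x')| +
        |y x' - y (floorPoint (r ^ κ) x')| := by
          rw [abs_sub_comm (y x')]
          exact (abs_sub_le _ (y (floorPoint (r ^ κ) x')) _).trans
            (add_le_add (abs_sub_le _ _ _) le_rfl)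
    _ ≤ (2 * C + 1) * r ^ β := by linarith

end Chaining

/-! ### Indices of the gauge -/

/-- Below the lower index, `ψ` decays faster than the corresponding power. -/
theorem eventually_le_rpow_of_lt_lowerIndex {ψ : ℝ → ℝ} {γ : ℝ} (h : (γ : EReal) < lowerIndex ψ) :
    ∀ᶠ r in 𝓝[>] (0 : ℝ), ψ r ≤ r ^ (2 * γ) := by
  obtain ⟨_, ⟨b, -, hb, rfl⟩, hγ⟩ := lt_sSup_iff.1 h
  have hγ : γ < b := by exact_mod_cast hγ
  filter_upwards [hb.eventually (gt_mem_nhds one_pos), eventually_nhdsGT_mem_Ioo one_pos]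
    with r hr hr0
  rw [div_lt_one (Real.rpow_pos_of_pos hr0.1 _)] at hr
  exact hr.le.trans (Real.rpow_le_rpow_of_exponent_ge hr0.1 hr0.2.le (by linarith))

/-- Below the upper index, `ψ` is bounded by the corresponding power along a sequence of scales. -/
theorem exists_frequently_le_rpow_of_lt_upperIndex {ψ : ℝ → ℝ} {β : ℝ} (hβ : 0 ≤ β)
    (h : (β : EReal) < upperIndex ψ) :
    ∃ M : ℝ, 0 < M ∧ ∃ᶠ r in 𝓝[>] (0 : ℝ), ψ r ≤ M * r ^ (2 * β) := by
  have hnot : ¬ Tendsto (fun r : ℝ => ψ r / r ^ (2 * β)) (𝓝[>] 0) atTop := fun ht =>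
    not_le.2 h (sInf_le ⟨β, hβ, ht, rfl⟩)
  rw [tendsto_atTop] at hnot
  push Not at hnot
  obtain ⟨M, hM⟩ := hnot
  refine ⟨max M 1, by positivity, (hM.and_eventually self_mem_nhdsWithin).mono ?_⟩
  rintro r ⟨h1, h2⟩
  have hp := Real.rpow_pos_of_pos (show 0 < r from h2) (2 * β)
  rw [div_lt_iff₀ hp] at h1
  exact h1.le.trans (by gcongr; exact le_max_left _ _)

/-! ### Oscillation of the random field -/

theorem norm_le_sqrt_mul {n : ℕ} {z : EuclideanSpace ℝ (Fin n)} {a : ℝ} (ha : 0 ≤ a)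
    (hz : ∀ i, |z i| ≤ a) : ‖z‖ ≤ √n * a := by
  rw [EuclideanSpace.norm_eq]
  refine Real.sqrt_le_iff.2 ⟨by positivity, ?_⟩
  rw [mul_pow, Real.sq_sqrt (Nat.cast_nonneg n)]
  calc ∑ i, ‖z i‖ ^ 2 ≤ ∑ _i : Fin n, a ^ 2 :=
        Finset.sum_le_sum fun i _ => pow_le_pow_left₀ (norm_nonneg _) (hz i) 2
    _ = n * a ^ 2 := by simp

section Field

variable {N d : ℕ} {Ω₀ Ω : Type*} [MeasurableSpace Ω₀] [MeasurableSpace Ω]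
  {P₀ : Measure Ω₀} [IsProbabilityMeasure P₀] {P : Measure Ω} [IsProbabilityMeasure P]
  {X₀ : EuclideanSpace ℝ (Fin N) → Ω₀ → ℝ}
  {X : EuclideanSpace ℝ (Fin N) → Ω → EuclideanSpace ℝ (Fin d)} {δ₀ : ℝ} {ψ : ℝ → ℝ}

/-- `ae_eventually_gridBound` for the coordinates of `X`. Points whose coordinates differ by at most
`3 r` are at distance at most `3 √N r`; the summand `1` keeps the factor positive if `N = 0`. -/
theorem ae_eventually_gridBound_coord (hX₀ : IsCenteredGaussianField P₀ X₀)
    (hX : IsFieldOfIndepCopies P₀ X₀ P X) (hδ₀ : 0 < δ₀) (hψ : MonotoneOn ψ (Set.Ico 0 δ₀))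
    (hC1 : IncrementVarianceBound P₀ X₀ δ₀ ψ) {r : ℕ → ℝ} (hr : ∀ n, 0 < r n)
    (hr2 : ∀ n, r n ≤ (1 / 2) ^ n) {κ R M β β' : ℝ} (hκ : 0 ≤ κ) (hR : 0 ≤ R) (hM : 0 < M)
    (hβ : β' < β) (hψr : ∀ᶠ n in atTop, ψ ((3 * √N + 1) * r n) ≤ M * r n ^ (2 * β)) (j : Fin d) :
    ∀ᵐ ω ∂P, ∀ᶠ n in atTop,
      GridBound (fun x => X x ω j) R (r n ^ κ) (r n) (r n ^ β') := by
  obtain ⟨C₂, hC₂, hvar⟩ := hC1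
  have hr0 : Tendsto (fun n => (3 * √N + 1) * r n) atTop (𝓝 0) := by
    simpa using (squeeze_zero (fun n => (hr n).le) hr2
      (tendsto_pow_atTop_nhds_zero_of_lt_one (by norm_num) (by norm_num))).const_mul (3 * √N + 1)
  refine ae_eventually_gridBound (Y := fun x ω => X x ω j) hr hr2 hκ hR (mul_pos hC₂ hM) hβ ?_
  filter_upwards [hψr, hr0.eventually (gt_mem_nhds hδ₀)] with n h1 h2 x y hxy t ht
  refine measure_le_abs_increment_le hX₀ hX j y x ?_ ht
  have hnorm : ‖x - y‖ ≤ (3 * √N + 1) * r n := by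
    refine (norm_le_sqrt_mul (by linarith [hr n]) hxy).trans ?_
    nlinarith [hr n]
  have := hvar y (x - y) (hnorm.trans_lt h2)
  rw [add_sub_cancel] at this
  refine this.trans ?_
  rw [mul_assoc]
  gcongr
  exact (hψ ⟨norm_nonneg _, hnorm.trans_lt h2⟩ ⟨(norm_nonneg _).trans hnorm, h2⟩ hnorm).trans h1

/-- Below the lower index of the gauge, the sample paths are almost surely locally Hölder
continuous. -/
theorem ae_exists_eventually_oscBound (hX₀ : IsCenteredGaussianField P₀ X₀)
    (hX : IsFieldOfIndepCopies P₀ X₀ P X) (hδ₀ : 0 < δ₀) (hψ : MonotoneOn ψ (Set.Ico 0 δ₀))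
    (hC1 : IncrementVarianceBound P₀ X₀ δ₀ ψ) {γ R : ℝ} (hγ : 0 < γ)
    (hγψ : (γ : EReal) < lowerIndex ψ) (hR : 0 ≤ R) :
    ∀ᵐ ω ∂P, ∃ m : ℕ, ∀ᶠ r in 𝓝[>] (0 : ℝ),
      OscBound (fun x => X x ω) (box N R) r (r ^ γ) m := by
  obtain ⟨γ', hγγ', hγ'ψ⟩ := EReal.lt_iff_exists_real_btwn.1 hγψ
  have hγγ' : γ < γ' := by exact_mod_cast hγγ'
  have hc : (0 : ℝ) < 3 * √N + 1 := by positivity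
  have hlim : Tendsto (fun n : ℕ => (3 * √N + 1) * (1 / 2 : ℝ) ^ n) atTop (𝓝[>] 0) := by
    refine tendsto_nhdsWithin_iff.2 ⟨?_, Eventually.of_forall fun n => mul_pos hc (by positivity)⟩
    simpa using (tendsto_pow_atTop_nhds_zero_of_lt_one (by norm_num : (0 : ℝ) ≤ 1 / 2)
      (by norm_num)).const_mul (3 * √N + 1)
  have hgrid : ∀ j : Fin d, ∀ᵐ ω ∂P, ∀ᶠ n : ℕ in atTop,
      GridBound (fun x => X x ω j) (R + 1) ((1 / 2) ^ n) ((1 / 2) ^ n) (((1 / 2) ^ n) ^ γ) := by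
    intro j
    have := ae_eventually_gridBound_coord hX₀ hX hδ₀ hψ hC1 (r := fun n => (1 / 2) ^ n)
      (fun n => by positivity) (fun n => le_rfl) (κ := 1) zero_le_one (by linarith : 0 ≤ R + 1)
      (Real.rpow_pos_of_pos hc (2 * γ')) hγγ' ?_ j
    · simpa only [Real.rpow_one] using this
    · filter_upwards [hlim.eventually (eventually_le_rpow_of_lt_lowerIndex hγ'ψ)] with n hn
      rwa [Real.mul_rpow hc.le (by positivity)] at hn
  filter_upwards [hX.continuous, ae_all_iff.2 hgrid] with ω hω hgridω
  choose C hC using fun j => exists_holder_of_gridBound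
    (y := fun x => X x ω j) (by fun_prop) hγ (hgridω j)
  refine ⟨⌈∑ j, |C j|⌉₊, ?_⟩
  filter_upwards [eventually_all.2 hC, self_mem_nhdsWithin] with r hr hr0 x hx x' hx' hxx' j
  refine (hr j x hx x' hx' hxx').trans ?_
  have := Real.rpow_nonneg (show 0 ≤ r from le_of_lt hr0) γ
  gcongr
  exact (le_abs_self _).trans ((Finset.single_le_sum (f := fun j => |C j|)
    (fun j _ => abs_nonneg _) (Finset.mem_univ j)).trans (Nat.le_ceil _))

/-- Below the upper index of the gauge, the oscillation bound holds almost surely along a sequence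
of scales. -/
theorem ae_exists_frequently_oscBound (hX₀ : IsCenteredGaussianField P₀ X₀)
    (hX : IsFieldOfIndepCopies P₀ X₀ P X) (hδ₀ : 0 < δ₀) (hψ : MonotoneOn ψ (Set.Ico 0 δ₀))
    (hC1 : IncrementVarianceBound P₀ X₀ δ₀ ψ) (hpos : 0 < lowerIndex ψ) {β R : ℝ} (hβ : 0 ≤ β)
    (hβψ : (β : EReal) < upperIndex ψ) (hR : 0 ≤ R) :
    ∀ᵐ ω ∂P, ∃ m : ℕ, ∃ᶠ r in 𝓝[>] (0 : ℝ),
      OscBound (fun x => X x ω) (box N R) r (r ^ β) m := by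
  obtain ⟨γ, hγ, hγψ⟩ := EReal.lt_iff_exists_real_btwn.1 hpos
  have hγ : 0 < γ := by exact_mod_cast hγ
  obtain ⟨β', hββ', hβ'ψ⟩ := EReal.lt_iff_exists_real_btwn.1 hβψ
  have hββ' : β < β' := by exact_mod_cast hββ'
  obtain ⟨M, hM, hfreq⟩ := exists_frequently_le_rpow_of_lt_upperIndex (hβ.trans hββ'.le) hβ'ψ
  have hc : (0 : ℝ) < 3 * √N + 1 := by positivity
  have hex : ∀ n : ℕ, ∃ r : ℝ, 0 < r ∧ r ≤ (1 / 2) ^ n ∧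
      ψ ((3 * √N + 1) * r) ≤ M * (3 * √N + 1) ^ (2 * β') * r ^ (2 * β') := by
    intro n
    obtain ⟨ρ, h1, h2, h3⟩ := (hfreq.and_eventually (eventually_nhdsGT_mem_Ioo
      (show (0 : ℝ) < (3 * √N + 1) * (1 / 2) ^ n by positivity))).exists
    refine ⟨ρ / (3 * √N + 1), by positivity, ?_, ?_⟩
    · rw [div_le_iff₀' hc]; exact h3.le
    · rw [mul_div_cancel₀ _ hc.ne', mul_assoc, ← Real.mul_rpow hc.le (by positivity),
        mul_div_cancel₀ _ hc.ne']
      exact h1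
  choose r hr hr2 hψr using hex
  have hr0 : Tendsto r atTop (𝓝[>] 0) :=
    tendsto_nhdsWithin_iff.2 ⟨squeeze_zero (fun n => (hr n).le) hr2
      (tendsto_pow_atTop_nhds_zero_of_lt_one (by norm_num) (by norm_num)),
      Eventually.of_forall hr⟩
  -- The lattice of mesh `r ^ κ` is so fine that the Hölder bound at this scale is below `r ^ β`.
  set κ : ℝ := max 1 (β / γ) with hκ
  have hκ1 : 1 ≤ κ := le_max_left _ _
  have hκβ : β ≤ κ * γ := (div_le_iff₀ hγ).1 (le_max_right _ _)
  have hR1 : 0 ≤ R + 1 := by linarith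
  filter_upwards [ae_exists_eventually_oscBound hX₀ hX hδ₀ hψ hC1 hγ hγψ hR1,
    ae_all_iff.2 fun j => ae_eventually_gridBound_coord hX₀ hX hδ₀ hψ hC1 hr hr2
      (zero_le_one.trans hκ1) hR1 (by positivity) hββ' (Eventually.of_forall hψr) j]
    with ω ⟨m, hm⟩ hgrid
  refine ⟨2 * m + 1, hr0.frequently (Eventually.frequently ?_)⟩
  filter_upwards [hr0.eventually ((tendsto_rpow_nhdsGT_zero (zero_lt_one.trans_le hκ1)).eventually
    hm), eventually_all.2 hgrid] with n h1 h2 x hx x' hx' hxx' j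
  have := abs_sub_le_of_gridBound (y := fun x => X x ω j) (hr n)
    ((hr2 n).trans (pow_le_one₀ (by norm_num) (by norm_num))) hκ1 hκβ m.cast_nonneg
    (fun x hx x' hx' hxx' => h1 x hx x' hx' hxx' j) (h2 j) hx hx' hxx'
  exact_mod_cast this

/-! ### Dimensions of the image measure -/

variable {μ : Measure (EuclideanSpace ℝ (Fin N))}

theorem exists_measure_compl_box_eq_zero (hμ : IsCompact μ.support) :
    ∃ R : ℝ, 0 ≤ R ∧ μ (box N R)ᶜ = 0 := by
  obtain ⟨R, hR⟩ := hμ.isBounded.exists_norm_le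
  refine ⟨max R 0, le_max_right _ _, measure_mono_null ?_ μ.measure_compl_support⟩
  refine Set.compl_subset_compl.2 fun x hx i => ?_
  exact ((PiLp.norm_apply_le x i).trans (hR x hx)).trans (le_max_left _ _)

theorem upperDim_map_le_dim [IsProbabilityMeasure μ] (hμ : IsCompact μ.support)
    {f : EuclideanSpace ℝ (Fin N) → EuclideanSpace ℝ (Fin d)} (hf : Continuous f) {q : ℝ}
    (hq : 0 < q) (hq1 : q ≠ 1) : upperDim q (μ.map f) ≤ d := by
  have := Measure.isProbabilityMeasure_map (μ := μ) hf.aemeasurable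
  obtain ⟨R, hR⟩ := (hμ.image hf).isBounded.exists_norm_le
  have hclosed : IsClosed {x : EuclideanSpace ℝ (Fin d) | ∀ j, |x j| ≤ max R 0} := by
    simp only [Set.ofPred_forall]
    exact isClosed_iInter fun j => isClosed_le (by fun_prop) continuous_const
  refine upperDim_le_of_bounded (le_max_right R 0) ?_ hq hq1
  rw [Measure.map_apply hf.measurable hclosed.measurableSet.compl]
  refine measure_mono_null ?_ μ.measure_compl_support
  refine Set.compl_subset_compl.2 fun x hx j => ?_
  exact ((PiLp.norm_apply_le (f x) j).trans (hR _ ⟨x, hx, rfl⟩)).trans (le_max_left _ _)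

/-- The exceptional null set is uniform in the Hölder exponent because only rational exponents are
used. -/
theorem ae_dim_image_le_of_lowerIndex [IsProbabilityMeasure μ]
    (hX₀ : IsCenteredGaussianField P₀ X₀) (hX : IsFieldOfIndepCopies P₀ X₀ P X) (hδ₀ : 0 < δ₀)
    (hψ : MonotoneOn ψ (Set.Ico 0 δ₀)) (hC1 : IncrementVarianceBound P₀ X₀ δ₀ ψ) {q : ℝ}
    (hq : 0 < q) (hq1 : q ≠ 1) (hμ : IsCompact μ.support) {α : ℝ} (hα : 0 < α)
    (hlower : lowerIndex ψ = α) :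
    ∀ᵐ ω ∂P, lowerDim q (imageMeasure μ X ω) ≤
        min (d : EReal) (((1 / α : ℝ) : EReal) * lowerDim q μ) ∧
      upperDim q (imageMeasure μ X ω) ≤
        min (d : EReal) (((1 / α : ℝ) : EReal) * upperDim q μ) := by
  obtain ⟨R, hR, hB⟩ := exists_measure_compl_box_eq_zero hμ
  have hosc : ∀ β : ℚ, ∀ᵐ ω ∂P, 0 < (β : ℝ) → (β : ℝ) < α → ∃ m : ℕ, ∀ᶠ r in 𝓝[>] (0 : ℝ),
      OscBound (fun x => X x ω) (box N R) r (r ^ (β : ℝ)) m := by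
    intro β
    by_cases hβ : 0 < (β : ℝ) ∧ (β : ℝ) < α
    · filter_upwards [ae_exists_eventually_oscBound hX₀ hX hδ₀ hψ hC1 hβ.1
        (by rw [hlower]; exact_mod_cast hβ.2) hR] with ω hω _ _ using hω
    · exact Eventually.of_forall fun ω h1 h2 => (hβ ⟨h1, h2⟩).elim
  filter_upwards [hX.continuous, ae_all_iff.2 hosc] with ω hω hoscω
  have hd := upperDim_map_le_dim hμ hω hq hq1
  refine ⟨le_min ((lowerDim_le_upperDim _ _).trans hd) (le_inv_mul_of_forall hα ?_),
    le_min hd (le_inv_mul_of_forall hα ?_)⟩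
  · intro β L L' h1 h2 hL hLL
    obtain ⟨m, hm⟩ := hoscω β h1 h2
    exact lowerDim_map_le hω.measurable hB h1 hq hq1 hLL hL hm
  · intro β L L' h1 h2 hL hLL
    obtain ⟨m, hm⟩ := hoscω β h1 h2
    exact upperDim_map_le hω.measurable hB h1 hq hq1 hLL hL hm

theorem ae_lowerDim_image_le_of_upperIndex [IsProbabilityMeasure μ]
    (hX₀ : IsCenteredGaussianField P₀ X₀) (hX : IsFieldOfIndepCopies P₀ X₀ P X) (hδ₀ : 0 < δ₀)
    (hψ : MonotoneOn ψ (Set.Ico 0 δ₀)) (hC1 : IncrementVarianceBound P₀ X₀ δ₀ ψ) {q : ℝ}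
    (hq : 0 < q) (hq1 : q ≠ 1) (hμ : IsCompact μ.support) {α : ℝ} (hα : 0 < α)
    (hlower : 0 < lowerIndex ψ) (hupper : upperIndex ψ = α) :
    ∀ᵐ ω ∂P, lowerDim q (imageMeasure μ X ω) ≤
      min (d : EReal) (((1 / α : ℝ) : EReal) * upperDim q μ) := by
  obtain ⟨R, hR, hB⟩ := exists_measure_compl_box_eq_zero hμ
  have hosc : ∀ β : ℚ, ∀ᵐ ω ∂P, 0 < (β : ℝ) → (β : ℝ) < α → ∃ m : ℕ, ∃ᶠ r in 𝓝[>] (0 : ℝ),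
      OscBound (fun x => X x ω) (box N R) r (r ^ (β : ℝ)) m := by
    intro β
    by_cases hβ : 0 < (β : ℝ) ∧ (β : ℝ) < α
    · filter_upwards [ae_exists_frequently_oscBound hX₀ hX hδ₀ hψ hC1 hlower hβ.1.le
        (by rw [hupper]; exact_mod_cast hβ.2) hR] with ω hω _ _ using hω
    · exact Eventually.of_forall fun ω h1 h2 => (hβ ⟨h1, h2⟩).elim
  filter_upwards [hX.continuous, ae_all_iff.2 hosc] with ω hω hoscω
  refine le_min ((lowerDim_le_upperDim _ _).trans (upperDim_map_le_dim hμ hω hq hq1))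
    (le_inv_mul_of_forall hα ?_)
  intro β L L' h1 h2 hL hLL
  obtain ⟨m, hm⟩ := hoscω β h1 h2
  exact lowerDim_map_le_of_upperDim hω.measurable hB h1 hq hq1 hLL hL hm

end Field

end RenyiImage

theorem proposition5p3 {N d : ℕ} {Ω₀ Ω : Type*} [MeasurableSpace Ω₀] [MeasurableSpace Ω]
    (P₀ : Measure Ω₀) [IsProbabilityMeasure P₀] (P : Measure Ω) [IsProbabilityMeasure P]
    (X₀ : EuclideanSpace ℝ (Fin N) → Ω₀ → ℝ)
    (hX₀ : RenyiImage.IsCenteredGaussianField P₀ X₀)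
    (X : EuclideanSpace ℝ (Fin N) → Ω → EuclideanSpace ℝ (Fin d))
    (hX : RenyiImage.IsFieldOfIndepCopies P₀ X₀ P X)
    (δ₀ : ℝ) (hδ₀ : 0 < δ₀) (ψ : ℝ → ℝ) (hψ : RenyiImage.IsGauge δ₀ ψ)
    (hC1 : RenyiImage.IncrementVarianceBound P₀ X₀ δ₀ ψ)
    (q : ℝ) (hq : 0 < q) (hq1 : q ≠ 1)
    (μ : Measure (EuclideanSpace ℝ (Fin N))) [IsProbabilityMeasure μ]
    (hμ : IsCompact μ.support) :
    (∀ α : ℝ, RenyiImage.lowerIndex ψ = α → RenyiImage.upperIndex ψ = α → 0 < α → α < 1 →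
      (∀ᵐ ω ∂P, RenyiImage.lowerDim q (RenyiImage.imageMeasure μ X ω) ≤
        min (d : EReal) (((1 / α : ℝ) : EReal) * RenyiImage.lowerDim q μ)) ∧
      (∀ᵐ ω ∂P, RenyiImage.upperDim q (RenyiImage.imageMeasure μ X ω) ≤
        min (d : EReal) (((1 / α : ℝ) : EReal) * RenyiImage.upperDim q μ))) ∧
    (∀ αl αu : ℝ, RenyiImage.lowerIndex ψ = αl → RenyiImage.upperIndex ψ = αu →
      0 < αl → αl ≤ αu → αu < 1 →
      (∀ᵐ ω ∂P, RenyiImage.lowerDim q (RenyiImage.imageMeasure μ X ω) ≤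
        min (d : EReal) (((1 / αu : ℝ) : EReal) * RenyiImage.upperDim q μ)) ∧
      (∀ᵐ ω ∂P, RenyiImage.upperDim q (RenyiImage.imageMeasure μ X ω) ≤
        min (d : EReal) (((1 / αl : ℝ) : EReal) * RenyiImage.upperDim q μ))) := by
  refine ⟨fun α hl _ hα _ => ?_, fun αl αu hl hu hαl hαlu _ => ?_⟩
  · exact eventually_and.1 (RenyiImage.ae_dim_image_le_of_lowerIndex hX₀ hX hδ₀ hψ.mono hC1 hq hq1
      hμ hα hl)
  · refine ⟨RenyiImage.ae_lowerDim_image_le_of_upperIndex hX₀ hX hδ₀ hψ.mono hC1 hq hq1 hμ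
      (hαl.trans_le hαlu) (by rw [hl]; exact_mod_cast hαl) hu, ?_⟩
    exact (RenyiImage.ae_dim_image_le_of_lowerIndex hX₀ hX hδ₀ hψ.mono hC1 hq hq1
      hμ hαl hl).mono fun ω h => h.2
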